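/- **Setting.** Let $\eta\in[0,1]$. The qubit amplitude damping channel of transmissivity $\eta$ is $$\mathcal A(\rho)=K_0\rho K_0^\dagger+K_1\rho K_1^\dagger,\qquad K_0=\begin{pmatrix}1&0\\0&\sqrt\eta\end{pmatrix},\qquad K_1=\begin{pmatrix}0&\sqrt{1-\eta}\\0&0\end{pmatrix}.$$ For a finite ensemble $\{p_X(x),|\phi^x\rangle_{AA'}\}$ of pure states, with $A$ finite-dimensional and $A'$ a qubit, put $$\rho_{XAB}=\sum_x p_X(x)\,|x\rangle\langle x|_X\otimes(\mathrm{id}_A\otimes\mathcal A_{A'\to B})(|\phi^x\rangle\langle\phi^x|_{AA'}),$$ and, with $H$ the von Neumann entropy to base $2$ of the indicated marginals of $\rho_{XAB}$, $$I(A\rangle BX)=H(BX)-H(ABX),\qquad I(X;B)=H(X)+H(B)-H(BX).$$ The single-letter classical–quantum trade-off region of $\mathcal A$ is the set of pairs $(C,Q)\in\mathbb R^2$ for which some such ensemble satisfies $$Q\le I(A\rangle BX),\qquad C+Q\le I(X;B)+I(A\rangle BX).$$ Let $h_2(y)=-y\log_2y-(1-y)\log_2(1-y)$ and $$\mathsf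 g(q,z,\nu)=h_2\!\left(\frac{1+\sqrt{(1-2zq)^2+4z\nu^2q(1-q)}}{2}\right).$$ **Theorem 2.** Let $\tfrac12\le\eta\le1$. The single-letter classical–quantum trade-off region of $\mathcal A$ is the union, over all $p,\nu\in[0,1]$, of the polyhedra of pairs $(C,Q)\in\mathbb R^2$ with $$Q\le \mathsf g(p,\eta,\nu)-\mathsf g(p,1-\eta,\nu),\qquad C+Q\le h_2(\eta p)-\mathsf g(p,1-\eta,\nu).$$ Moreover, it is achieved by the following ensembles: for all $p,\nu\in[0,1]$ the two matrices $$\rho^0=\begin{pmatrix}1-p&\nu\sqrt{p(1-p)}\\ \nu\sqrt{p(1-p)}&p\end{pmatrix},\qquad \rho^1=\begin{pmatrix}1-p&-\nu\sqrt{p(1-p)}\\ -\nu\sqrt{p(1-p)}&p\end{pmatrix}$$ are qubit density matrices, and every ensemble that consists, with probability $\tfrac12$ each, of purifications $|\phi^0\rangle,|\phi^1\rangle$ of $\rho^0,\rho^1$ satisfies $$I(A\rangle BX)=\mathsf g(p,\eta,\nu)-\mathsf g(p,1-\eta,\nu),\qquad I(X;B)+I(A\rangle BX)=h_2(\eta p)-\mathsf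 g(p,1-\eta,\nu).$$ -/

import Mathlib

open scoped Kronecker

noncomputable section

namespace CQTradeoff

/-- The binary Shannon entropy in bits. -/
def h2 (y : ℝ) : ℝ := -y * Real.logb 2 y - (1 - y) * Real.logb 2 (1 - y)

/-- `g(q, z, ν) = h₂((1 + √((1 - 2zq)² + 4zν²q(1 - q))) / 2)`. -/
def g (q z ν : ℝ) : ℝ :=
  h2 ((1 + Real.sqrt ((1 - 2 * z * q) ^ 2 + 4 * z * ν ^ 2 * q * (1 - q))) / 2)

open Classical in
/-- The von Neumann entropy `-Tr (ρ log₂ ρ)` in bits, computed from the eigenvalues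
(it is only ever applied to Hermitian matrices; the value `0` elsewhere is a dummy). -/
def entropy {n : Type*} [Fintype n] [DecidableEq n] (ρ : Matrix n n ℂ) : ℝ :=
  if h : ρ.IsHermitian then -∑ i, h.eigenvalues i * Real.logb 2 (h.eigenvalues i) else 0

/-- Partial trace over the first tensor factor. -/
def traceLeft {m n : Type*} [Fintype m] (M : Matrix (m × n) (m × n) ℂ) : Matrix n n ℂ :=
  Matrix.of fun i j => ∑ a, M (a, i) (a, j)

/-- Partial trace over the second tensor factor. -/
def traceRight {m n : Type*} [Fintype n] (M : Matrix (m × n) (m × n) ℂ) : Matrix m m ℂ :=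
  Matrix.of fun i j => ∑ b, M (i, b) (j, b)

/-- Partial trace over the middle one of three tensor factors. -/
def traceMiddle {l m n : Type*} [Fintype m] (M : Matrix (l × m × n) (l × m × n) ℂ) :
    Matrix (l × n) (l × n) ℂ :=
  Matrix.of fun i j => ∑ a, M (i.1, a, i.2) (j.1, a, j.2)

/-- The rank-one operator `|φ⟩⟨φ|`. -/
def ketBra {n : Type*} (φ : n → ℂ) : Matrix n n ℂ := Matrix.vecMulVec φ (star φ)

/-- `id_A ⊗ 𝒩`: the map `𝒩` acts on the second tensor factor. -/
def applyRight {A A' B : Type*} (𝒩 : Matrix A' A' ℂ →ₗ[ℂ] Matrix B B ℂ)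
    (M : Matrix (A × A') (A × A') ℂ) : Matrix (A × B) (A × B) ℂ :=
  Matrix.of fun i j => 𝒩 (Matrix.of fun s t => M (i.1, s) (j.1, t)) i.2 j.2

/-- The map `ρ ↦ ∑ⱼ Kⱼ ρ Kⱼ†`. -/
def krausMap {J A' B : Type*} [Fintype J] [Fintype A'] (K : J → Matrix B A' ℂ) :
    Matrix A' A' ℂ →ₗ[ℂ] Matrix B B ℂ where
  toFun ρ := ∑ j, K j * ρ * (K j).conjTranspose
  map_add' ρ σ := by simp [Matrix.mul_add, Matrix.add_mul, Finset.sum_add_distrib]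
  map_smul' c ρ := by simp [Finset.smul_sum]

/-- The qubit amplitude damping channel of transmissivity `η`. Index `0` is the state that the
channel leaves fixed, index `1` the state that decays into it. -/
def amplitudeDamping (η : ℝ) : Matrix (Fin 2) (Fin 2) ℂ →ₗ[ℂ] Matrix (Fin 2) (Fin 2) ℂ :=
  krausMap (J := Fin 2)
    ![!![1, 0; 0, (Real.sqrt η : ℂ)], !![0, (Real.sqrt (1 - η) : ℂ); 0, 0]]

/-- An ensemble `{p_X(x), |φˣ⟩_{AA'}}` of bipartite pure states. -/
structure Ensemble (X A A' : Type*) [Fintype X] [Fintype A] [Fintype A'] where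
  prob : X → ℝ
  prob_nonneg : ∀ x, 0 ≤ prob x
  prob_sum : ∑ x, prob x = 1
  φ : X → A × A' → ℂ
  φ_unit : ∀ x, ∑ i, ‖φ x i‖ ^ 2 = 1

namespace Ensemble

variable {X A A' B : Type*} [Fintype X] [Fintype A] [Fintype A'] [Fintype B]
  [DecidableEq X] [DecidableEq A] [DecidableEq B]

/-- The channel input `ρˣ_{A'}`, of which `φˣ` is a purification. -/
def inputState (e : Ensemble X A A') (x : X) : Matrix A' A' ℂ :=
  traceLeft (ketBra (e.φ x))

/-- The classical-quantum state
`ρ_{XAB} = ∑ₓ p_X(x) |x⟩⟨x|_X ⊗ 𝒩_{A' → B}(|φˣ⟩⟨φˣ|_{AA'})`. -/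
def cqState (e : Ensemble X A A') (𝒩 : Matrix A' A' ℂ →ₗ[ℂ] Matrix B B ℂ) :
    Matrix (X × A × B) (X × A × B) ℂ :=
  ∑ x, (e.prob x : ℂ) • (Matrix.single x x (1 : ℂ) ⊗ₖ applyRight 𝒩 (ketBra (e.φ x)))

/-- The coherent information `I(A⟩BX) = H(BX) - H(ABX)`. -/
def coherentInfo (e : Ensemble X A A') (𝒩 : Matrix A' A' ℂ →ₗ[ℂ] Matrix B B ℂ) : ℝ :=
  entropy (traceMiddle (e.cqState 𝒩)) - entropy (e.cqState 𝒩)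

/-- The Holevo information `I(X;B) = H(X) + H(B) - H(BX)`. -/
def holevoInfo (e : Ensemble X A A') (𝒩 : Matrix A' A' ℂ →ₗ[ℂ] Matrix B B ℂ) : ℝ :=
  entropy (traceRight (e.cqState 𝒩)) + entropy (traceLeft (traceLeft (e.cqState 𝒩)))
    - entropy (traceMiddle (e.cqState 𝒩))

end Ensemble

/-- The single-letter classical-quantum trade-off region of a channel: the rate pairs `(C, Q)`
with `Q ≤ I(A⟩BX)` and `C + Q ≤ I(X;B) + I(A⟩BX)` for some finite ensemble. -/
def tradeoffRegion {A' B : Type*} [Fintype A'] [Fintype B] [DecidableEq B]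
    (𝒩 : Matrix A' A' ℂ →ₗ[ℂ] Matrix B B ℂ) : Set (ℝ × ℝ) :=
  {r | ∃ (k d : ℕ) (e : Ensemble (Fin k) (Fin d) A'),
    r.2 ≤ e.coherentInfo 𝒩 ∧ r.1 + r.2 ≤ e.holevoInfo 𝒩 + e.coherentInfo 𝒩}

/-- The polyhedron of rate pairs `(C, Q)` with parameters `p, ν`. -/
def polyhedron (η p ν : ℝ) : Set (ℝ × ℝ) :=
  {r | r.2 ≤ g p η ν - g p (1 - η) ν ∧ r.1 + r.2 ≤ h2 (η * p) - g p (1 - η) ν}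

/-- The matrix with diagonal `(1 - p, p)` and off-diagonal entries `ν √(p (1 - p))`. -/
def qubitState (p ν : ℝ) : Matrix (Fin 2) (Fin 2) ℂ :=
  !![((1 - p : ℝ) : ℂ), ((ν * Real.sqrt (p * (1 - p)) : ℝ) : ℂ);
     ((ν * Real.sqrt (p * (1 - p)) : ℝ) : ℂ), (p : ℂ)]

/-- The ensemble consists of purifications of the two states with diagonal `(1 - p, p)` and
off-diagonal entries `±ν √(p (1 - p))`, taken with probability `1/2` each. -/
def IsSymmetricEnsemble {A : Type*} [Fintype A] (p ν : ℝ)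
    (e : Ensemble (Fin 2) A (Fin 2)) : Prop :=
  (∀ x, e.prob x = 1 / 2) ∧
    e.inputState 0 = qubitState p ν ∧ e.inputState 1 = qubitState p (-ν)

end CQTradeoff

end

noncomputable section

namespace CQTradeoff

open Set Filter Topology

/-! ### The logarithmic ratio `log ((1 + r) / (1 - r))` -/

/-! Write `φ = detEntropy`. An input of population `p` and relative coherence `ν` gives output and
environment states of determinants `outDet η p ν` and `outDet (1 - η) p ν`, since the environment
sees damping of transmissivity `1 - η`. For an ensemble, `I(A⟩BX)` is therefore the average output
entropy minus the average environment entropy, and `I(X;B) + I(A⟩BX)` is `H(B)` minus the average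
environment entropy. Dropping the coherence of the average output bounds `H(B)` by the binary
entropy of `η` times the mean population; the opposite coherences of the symmetric ensemble cancel,
so it attains this bound.

It remains to replace an ensemble by one pair: at the mean population there must be a `ν` with
exactly the average environment entropy and at least the average output entropy
(`exists_coherence_sum`). For `η < 1` the coherence can be eliminated: by `outDet_eq_sub` the output
entropy is `φ (a φ⁻¹(u) - b p²)`, where `u` is the environment entropy, `a = η / (1 - η)` and `b = η
(2η - 1)`. The claim is that this is concave in `(p, u)` on a convex domain (`convex_hypograph`).

Along a segment on which `u` varies, concavity says that the derivative of the output entropy in `u`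
decreases. This is a quadratic inequality (`mul_elasticity_le`) that needs only three properties of
the elasticity `-D φ''/φ'`: it is positive, it increases with `D`, and it is at most `1/2`. The last
also makes the domain convex (`convexOn_detEntropy_sq`). The case `η = 1`, where the environment
entropy vanishes, is Jensen's inequality. -/

/-- `log ((1 + r) / (1 - r))`, twice the inverse hyperbolic tangent. -/
def logRatio (r : ℝ) : ℝ := Real.log (1 + r) - Real.log (1 - r)

lemma logRatio_zero : logRatio 0 = 0 := by simp [logRatio]

lemma hasDerivAt_logRatio {r : ℝ} (h0 : 0 ≤ r) (h1 : r < 1) :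
    HasDerivAt logRatio (2 / (1 - r ^ 2)) r := by
  have hp : (1 + r) ≠ 0 := by linarith
  have hm : (1 - r) ≠ 0 := by linarith
  have hd := (((hasDerivAt_id r).const_add 1).log hp).sub (((hasDerivAt_id r).const_sub 1).log hm)
  refine HasDerivAt.congr_deriv hd ?_
  have : 1 - r ^ 2 ≠ 0 := by
    have : 1 - r ^ 2 = (1 + r) * (1 - r) := by ring
    rw [this]; positivity
  simp only [id]
  field_simp
  ring

/-- A function with nonnegative derivative on `[0, 1)` that vanishes at `0` is nonnegative. -/
lemma nonneg_of_hasDerivAt_nonneg {f f' : ℝ → ℝ} (h0 : f 0 = 0)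
    (hf : ∀ r, 0 ≤ r → r < 1 → HasDerivAt f (f' r) r)
    (hf' : ∀ r, 0 < r → r < 1 → 0 ≤ f' r) {r : ℝ} (hr0 : 0 ≤ r) (hr1 : r < 1) : 0 ≤ f r := by
  have hmono : MonotoneOn f (Ico 0 1) := by
    apply monotoneOn_of_deriv_nonneg (convex_Ico 0 1)
    · exact fun x hx => (hf x hx.1 hx.2).continuousAt.continuousWithinAt
    · rw [interior_Ico]
      exact fun x hx => (hf x hx.1.le hx.2).differentiableAt.differentiableWithinAt
    · rw [interior_Ico]
      intro x hx
      rw [(hf x hx.1.le hx.2).deriv]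
      exact hf' x hx.1 hx.2
  simpa [h0] using hmono (⟨le_rfl, one_pos⟩ : (0 : ℝ) ∈ Ico (0 : ℝ) 1) ⟨hr0, hr1⟩ hr0

lemma one_sub_sq_pos {r : ℝ} (h0 : 0 ≤ r) (h1 : r < 1) : 0 < 1 - r ^ 2 := by nlinarith

lemma two_mul_le_logRatio {r : ℝ} (h0 : 0 ≤ r) (h1 : r < 1) : 2 * r ≤ logRatio r := by
  have := nonneg_of_hasDerivAt_nonneg (f := fun r => logRatio r - 2 * r)
    (f' := fun r => 2 / (1 - r ^ 2) - 2 * 1) (by simp [logRatio_zero])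
    (fun r h0 h1 => (hasDerivAt_logRatio h0 h1).sub ((hasDerivAt_id r).const_mul 2))
    (fun r h0 h1 => by
      have h := one_sub_sq_pos h0.le h1
      have : 2 / (1 - r ^ 2) - 2 * 1 = 2 * r ^ 2 / (1 - r ^ 2) := by field_simp; ring
      rw [this]; positivity) h0 h1
  linarith

lemma logRatio_pos {r : ℝ} (h0 : 0 < r) (h1 : r < 1) : 0 < logRatio r := by
  linarith [two_mul_le_logRatio h0.le h1]

/-- This bound is the sign of the derivative needed for `logRatio_sq_le`. Dividing by the polynomial
factor isolates the logarithm, so that differentiating leaves a rational inequality. -/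
lemma logRatio_le {r : ℝ} (h0 : 0 ≤ r) (h1 : r < 1) :
    (1 - r ^ 2) * (3 + r ^ 2) * logRatio r ≤ 2 * r * (3 - r ^ 2) := by
  have key := nonneg_of_hasDerivAt_nonneg
    (f := fun r => 2 * r * (3 - r ^ 2) / ((1 - r ^ 2) * (3 + r ^ 2)) - logRatio r)
    (f' := fun r => ((2 * 1 * (3 - r ^ 2) + 2 * r * (-(2 * r))) * ((1 - r ^ 2) * (3 + r ^ 2))
      - 2 * r * (3 - r ^ 2) * (-(2 * r) * (3 + r ^ 2) + (1 - r ^ 2) * (2 * r)))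
      / ((1 - r ^ 2) * (3 + r ^ 2)) ^ 2 - 2 / (1 - r ^ 2)) (by simp [logRatio_zero])
    (fun r h0 h1 => by
      have h := one_sub_sq_pos h0 h1
      have hsq : HasDerivAt (fun r : ℝ => r ^ 2) (2 * r) r := by
        simpa using hasDerivAt_pow 2 r
      exact ((((hasDerivAt_id r).const_mul 2).mul (hsq.const_sub 3)).div
        ((hsq.const_sub 1).mul (hsq.const_add 3)) (mul_pos h (by positivity)).ne').sub (hasDerivAt_logRatio h0 h1))
    (fun r h0 h1 => by
      have h := one_sub_sq_pos h0.le h1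
      rw [sub_nonneg, div_le_div_iff₀ h (by positivity)]
      -- The difference of the two sides of the goal is `32 r⁴ (1 - r²)`.
      have : 0 ≤ r ^ 4 * (1 - r ^ 2) * (9 + r ^ 2) := by positivity
      nlinarith [this]) h0 h1
  have h := one_sub_sq_pos h0 h1
  rw [sub_nonneg, le_div_iff₀ (by positivity)] at key
  linarith

/-- Up to a positive factor, this is the sign of the derivative of `elasticity`. -/
lemma logRatio_sq_le {r : ℝ} (h0 : 0 ≤ r) (h1 : r < 1) :
    (1 - r ^ 2) * logRatio r ^ 2 ≤ 2 * r ^ 2 + (1 - r ^ 2) * (r * logRatio r) := by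
  have key := nonneg_of_hasDerivAt_nonneg
    (f := fun r => 2 * r ^ 2 / (1 - r ^ 2) + r * logRatio r - logRatio r ^ 2)
    (f' := fun r => (2 * (2 * r) * (1 - r ^ 2) - 2 * r ^ 2 * (-(2 * r))) / (1 - r ^ 2) ^ 2
      + (1 * logRatio r + r * (2 / (1 - r ^ 2)))
      - 2 * logRatio r * (2 / (1 - r ^ 2))) (by simp [logRatio_zero])
    (fun r h0 h1 => by
      have h := one_sub_sq_pos h0 h1
      have hsq : HasDerivAt (fun r : ℝ => r ^ 2) (2 * r) r := by
        simpa using hasDerivAt_pow 2 r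
      have hl := hasDerivAt_logRatio h0 h1
      refine (((hsq.const_mul 2).div (hsq.const_sub 1) h.ne').add
        ((hasDerivAt_id r).mul hl)).sub ?_
      exact (hl.fun_pow 2).congr_deriv (by simp))
    (fun r h0 h1 => by
      have h := one_sub_sq_pos h0.le h1
      have e : (2 * (2 * r) * (1 - r ^ 2) - 2 * r ^ 2 * (-(2 * r))) / (1 - r ^ 2) ^ 2
          + (1 * logRatio r + r * (2 / (1 - r ^ 2))) - 2 * logRatio r * (2 / (1 - r ^ 2))
          = (2 * r * (3 - r ^ 2) - (1 - r ^ 2) * (3 + r ^ 2) * logRatio r) / (1 - r ^ 2) ^ 2 := by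
        field_simp; ring
      rw [e]
      have := logRatio_le h0.le h1
      apply div_nonneg <;> nlinarith) h0 h1
  have h := one_sub_sq_pos h0 h1
  have e : (2 * r ^ 2 / (1 - r ^ 2) + r * logRatio r - logRatio r ^ 2) * (1 - r ^ 2)
    = 2 * r ^ 2 + (1 - r ^ 2) * (r * logRatio r) - (1 - r ^ 2) * logRatio r ^ 2 := by
    field_simp
  have := mul_nonneg key h.le
  rw [e] at this
  linarith

lemma one_sub_sq_mul_logRatio_lt {r : ℝ} (h0 : 0 < r) (h1 : r < 1) :
    (1 - r ^ 2) * logRatio r < 2 * r := by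
  have h := one_sub_sq_pos h0.le h1
  have := logRatio_le h0.le h1
  have h3 : 2 * r * (3 - r ^ 2) < 2 * r * (3 + r ^ 2) := by
    have : 0 < r ^ 2 := by positivity
    have : 0 < r * r ^ 2 := by positivity
    nlinarith
  have : (3 + r ^ 2) * ((1 - r ^ 2) * logRatio r) < (3 + r ^ 2) * (2 * r) := by nlinarith
  exact lt_of_mul_lt_mul_left this (by positivity)

/-- The elasticity `-D φ''(D) / φ'(D)` of the entropy `φ` of a qubit state as a function of its
determinant `D = (1 - r²) / 4`. -/
def elasticity (r : ℝ) : ℝ := (2 * r - (1 - r ^ 2) * logRatio r) / (2 * r ^ 2 * logRatio r)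

lemma elasticity_pos {r : ℝ} (h0 : 0 < r) (h1 : r < 1) : 0 < elasticity r := by
  have := logRatio_pos h0 h1
  have := one_sub_sq_mul_logRatio_lt h0 h1
  exact div_pos (by linarith) (by positivity)

/-- After clearing denominators this is exactly `2 r ≤ logRatio r`. -/
lemma elasticity_le_half {r : ℝ} (h0 : 0 < r) (h1 : r < 1) : elasticity r ≤ 1 / 2 := by
  have := logRatio_pos h0 h1
  have := two_mul_le_logRatio h0.le h1
  rw [elasticity, div_le_div_iff₀ (by positivity) (by norm_num)]
  linarith

lemma elasticity_antitoneOn : AntitoneOn elasticity (Ioo 0 1) := by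
  have hd : ∀ r ∈ Ioo (0 : ℝ) 1, HasDerivAt elasticity
      (((2 * 1 - (-(2 * r) * logRatio r + (1 - r ^ 2) * (2 / (1 - r ^ 2))))
          * (2 * r ^ 2 * logRatio r)
        - (2 * r - (1 - r ^ 2) * logRatio r)
          * (2 * (2 * r) * logRatio r + 2 * r ^ 2 * (2 / (1 - r ^ 2))))
        / (2 * r ^ 2 * logRatio r) ^ 2) r := by
    intro r hr
    have hl := hasDerivAt_logRatio hr.1.le hr.2
    have hp := logRatio_pos hr.1 hr.2
    have hr0 := hr.1
    have hsq : HasDerivAt (fun r : ℝ => r ^ 2) (2 * r) r := by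
      simpa using hasDerivAt_pow 2 r
    exact (((hasDerivAt_id r).const_mul 2).sub ((hsq.const_sub 1).mul hl)).div
      ((hsq.const_mul 2).mul hl) (by positivity)
  apply antitoneOn_of_deriv_nonpos (convex_Ioo 0 1)
  · exact fun r hr => (hd r hr).continuousAt.continuousWithinAt
  · rw [interior_Ioo]
    exact fun r hr => (hd r hr).differentiableAt.differentiableWithinAt
  · rw [interior_Ioo]
    intro r hr
    rw [(hd r hr).deriv]
    apply div_nonpos_of_nonpos_of_nonneg _ (by positivity)
    have h := one_sub_sq_pos hr.1.le hr.2
    have hq := logRatio_sq_le hr.1.le hr.2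
    have hr0 := hr.1
    have e : (2 * 1 - (-(2 * r) * logRatio r + (1 - r ^ 2) * (2 / (1 - r ^ 2))))
          * (2 * r ^ 2 * logRatio r)
        - (2 * r - (1 - r ^ 2) * logRatio r)
          * (2 * (2 * r) * logRatio r + 2 * r ^ 2 * (2 / (1 - r ^ 2)))
        = 4 * r * ((1 - r ^ 2) * logRatio r ^ 2
          - (2 * r ^ 2 + (1 - r ^ 2) * (r * logRatio r))) / (1 - r ^ 2) := by
      field_simp; ring
    rw [e]
    apply div_nonpos_of_nonpos_of_nonneg _ h.le
    exact mul_nonpos_of_nonneg_of_nonpos (by positivity) (by linarith)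

/-! ### The entropy of a qubit state as a function of its determinant -/

/-- The entropy, in nats, of a qubit state of determinant `D`. -/
def detEntropy (D : ℝ) : ℝ := Real.binEntropy ((1 + √(1 - 4 * D)) / 2)

/-- The derivative of `detEntropy`. -/
def detEntropyDeriv (D : ℝ) : ℝ := logRatio √(1 - 4 * D) / √(1 - 4 * D)

lemma continuous_detEntropy : Continuous detEntropy := by
  unfold detEntropy; fun_prop

lemma sqrt_one_sub_mem {D : ℝ} (h : D ∈ Ioo (0 : ℝ) (1 / 4)) :
    √(1 - 4 * D) ∈ Ioo (0 : ℝ) 1 := by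
  refine ⟨Real.sqrt_pos.2 (by linarith [h.2]), ?_⟩
  rw [Real.sqrt_lt' one_pos]
  linarith [h.1]

lemma hasDerivAt_sqrt_one_sub {D : ℝ} (h : D ∈ Ioo (0 : ℝ) (1 / 4)) :
    HasDerivAt (fun D => √(1 - 4 * D)) (-2 / √(1 - 4 * D)) D := by
  have hd := (((hasDerivAt_id D).const_mul 4).const_sub 1).sqrt
    (by simp only [id]; linarith [h.2])
  refine HasDerivAt.congr_deriv hd ?_
  simp only [id]
  have := (sqrt_one_sub_mem h).1
  field_simp; norm_num

lemma hasDerivAt_detEntropy {D : ℝ} (h : D ∈ Ioo (0 : ℝ) (1 / 4)) :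
    HasDerivAt detEntropy (detEntropyDeriv D) D := by
  have hr := sqrt_one_sub_mem h
  have hb := Real.hasDerivAt_binEntropy (p := (1 + √(1 - 4 * D)) / 2)
    (by linarith [hr.1]) (by linarith [hr.2])
  have hd := hb.comp D (((hasDerivAt_sqrt_one_sub h).const_add 1).div_const 2)
  refine HasDerivAt.congr_deriv hd ?_
  have e1 : 1 - (1 + √(1 - 4 * D)) / 2 = (1 - √(1 - 4 * D)) / 2 := by ring
  have := hr.1
  have := hr.2
  rw [e1, Real.log_div (by linarith) (by norm_num), Real.log_div (by linarith) (by norm_num),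
    detEntropyDeriv, logRatio]
  field_simp
  ring

lemma detEntropyDeriv_pos {D : ℝ} (h : D ∈ Ioo (0 : ℝ) (1 / 4)) : 0 < detEntropyDeriv D :=
  div_pos (logRatio_pos (sqrt_one_sub_mem h).1 (sqrt_one_sub_mem h).2) (sqrt_one_sub_mem h).1

/-- Written through `elasticity`, so that later estimates use only its sign, its monotonicity and
the bound `1/2`. -/
lemma hasDerivAt_detEntropyDeriv {D : ℝ} (h : D ∈ Ioo (0 : ℝ) (1 / 4)) :
    HasDerivAt detEntropyDeriv
      (-(elasticity √(1 - 4 * D) / D * detEntropyDeriv D)) D := by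
  have hr := sqrt_one_sub_mem h
  have hd := ((hasDerivAt_logRatio hr.1.le hr.2).div (hasDerivAt_id _) hr.1.ne').comp D
    (hasDerivAt_sqrt_one_sub h)
  refine HasDerivAt.congr_deriv hd ?_
  have hl := logRatio_pos hr.1 hr.2
  have h1 := one_sub_sq_pos hr.1.le hr.2
  have hD : D = (1 - √(1 - 4 * D) ^ 2) / 4 := by
    rw [Real.sq_sqrt (by linarith [h.2])]; ring
  simp only [id, detEntropyDeriv, elasticity]
  generalize √(1 - 4 * D) = r at *
  subst hD
  have := hr.1
  field_simp
  ring

lemma strictMonoOn_detEntropy : StrictMonoOn detEntropy (Icc 0 (1 / 4)) := by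
  intro x hx y hy hxy
  have hlt : √(1 - 4 * y) < √(1 - 4 * x) :=
    Real.sqrt_lt_sqrt (by linarith [hy.2]) (by linarith)
  have hle : √(1 - 4 * x) ≤ 1 := Real.sqrt_le_one.2 (by linarith [hx.1])
  have h0 := Real.sqrt_nonneg (1 - 4 * y)
  apply Real.binEntropy_strictAntiOn
  · constructor <;> linarith
  · constructor <;> linarith
  · linarith

lemma detEntropy_mul_one_sub (y : ℝ) : detEntropy (y * (1 - y)) = Real.binEntropy y := by
  have e : 1 - 4 * (y * (1 - y)) = (1 - 2 * y) ^ 2 := by ring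
  rw [detEntropy, e, Real.sqrt_sq_eq_abs]
  rcases abs_cases (1 - 2 * y) with ⟨h, -⟩ | ⟨h, -⟩
  · rw [h, ← Real.binEntropy_one_sub y]; ring_nf
  · rw [h]; ring_nf

lemma concaveOn_detEntropy : ConcaveOn ℝ (Icc 0 (1 / 4)) detEntropy := by
  apply concaveOn_of_hasDerivWithinAt2_nonpos (convex_Icc _ _) continuous_detEntropy.continuousOn
    (f' := detEntropyDeriv) (f'' := fun D => -(elasticity √(1 - 4 * D) / D * detEntropyDeriv D))
  all_goals
    rw [interior_Icc]
    intro x hx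
  · exact (hasDerivAt_detEntropy hx).hasDerivWithinAt
  · exact (hasDerivAt_detEntropyDeriv hx).hasDerivWithinAt
  · have := elasticity_pos (sqrt_one_sub_mem hx).1 (sqrt_one_sub_mem hx).2
    have := detEntropyDeriv_pos hx
    have := hx.1
    rw [neg_nonpos]; positivity

/-- The entropy of a qubit state is a convex function of the square root of its determinant. -/
lemma convexOn_detEntropy_sq {θ : ℝ} (h0 : 0 ≤ θ) (h1 : θ ≤ 1 / 4) :
    ConvexOn ℝ (Icc 0 1) fun p => detEntropy (θ * p ^ 2) := by
  rcases h0.eq_or_lt with rfl | h0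
  · simpa using convexOn_const _ (convex_Icc (0 : ℝ) 1)
  have hmem : ∀ p ∈ Ioo (0 : ℝ) 1, θ * p ^ 2 ∈ Ioo (0 : ℝ) (1 / 4) := fun p hp => by
    have := hp.1
    have := hp.2
    exact ⟨by positivity, by nlinarith⟩
  have hsq : ∀ p : ℝ, HasDerivAt (fun r : ℝ => θ * r ^ 2) (θ * (2 * p)) p := fun p => by
    simpa using (hasDerivAt_pow 2 p).const_mul θ
  apply convexOn_of_hasDerivWithinAt2_nonneg (convex_Icc _ _)
    (continuous_detEntropy.comp (by fun_prop)).continuousOn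
    (f' := fun p => detEntropyDeriv (θ * p ^ 2) * (θ * (2 * p)))
    (f'' := fun p => -(elasticity √(1 - 4 * (θ * p ^ 2)) / (θ * p ^ 2)
      * detEntropyDeriv (θ * p ^ 2)) * (θ * (2 * p)) * (θ * (2 * p))
      + detEntropyDeriv (θ * p ^ 2) * (θ * (2 * 1)))
  all_goals
    rw [interior_Icc]
    intro p hp
  · exact ((hasDerivAt_detEntropy (hmem p hp)).comp p (hsq p)).hasDerivWithinAt
  · exact (((hasDerivAt_detEntropyDeriv (hmem p hp)).comp p (hsq p)).mul
      (((hasDerivAt_id p).const_mul 2).const_mul θ)).hasDerivWithinAt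
  · have hr := sqrt_one_sub_mem (hmem p hp)
    have h2 := elasticity_le_half hr.1 hr.2
    have h3 := detEntropyDeriv_pos (hmem p hp)
    have hp0 := hp.1
    generalize elasticity √(1 - 4 * (θ * p ^ 2)) = τ at *
    generalize detEntropyDeriv (θ * p ^ 2) = φ at *
    have e : -(τ / (θ * p ^ 2) * φ) * (θ * (2 * p)) * (θ * (2 * p)) + φ * (θ * (2 * 1))
      = 2 * θ * φ * (1 - 2 * τ) := by field_simp; ring
    rw [e]
    exact mul_nonneg (by positivity) (by linarith)

/-! ### Concavity of the output entropy as a function of the environment entropy -/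

/-- The quadratic form inequality behind the concavity of `(p, u) ↦ φ (a φ⁻¹(u) - b p²)`. -/
lemma mul_elasticity_le {D v a b p y : ℝ} (hD : D ∈ Ioo (0 : ℝ) (1 / 4))
    (hv : v ∈ Ioo (0 : ℝ) (1 / 4)) (hDv : D ≤ v) (ha : 0 ≤ a) (hb : 0 ≤ b)
    (hvp : v = a * D - b * p ^ 2) :
    a * (elasticity √(1 - 4 * D) / D)
      ≤ elasticity √(1 - 4 * v) / v * (a - 2 * b * p * y) ^ 2 + 2 * b * y ^ 2 := by
  have hrD := sqrt_one_sub_mem hD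
  have hrv := sqrt_one_sub_mem hv
  have hle : elasticity √(1 - 4 * D) ≤ elasticity √(1 - 4 * v) :=
    elasticity_antitoneOn hrv hrD (Real.sqrt_le_sqrt (by linarith))
  have hpos := elasticity_pos hrD.1 hrD.2
  have hhalf := elasticity_le_half hrv.1 hrv.2
  generalize elasticity √(1 - 4 * D) = τ at *
  generalize elasticity √(1 - 4 * v) = σ at *
  have hD0 := hD.1
  have hv0 := hv.1
  have hσ : 0 < σ := hpos.trans_le hle
  have hw : 0 ≤ b * p ^ 2 := by positivity
  -- The minimum over `y` of the right-hand side is `a² k / (1 + 2 b p² k)`; `h2` is this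
  -- minimisation and `h1` compares the minimum with the left-hand side.
  set k := σ / v with hk
  have hk0 : 0 < k := div_pos hσ hv0
  have hσk : σ = k * v := by rw [hk]; field_simp
  have h1 : (τ / D) * (1 + 2 * (b * p ^ 2) * k) ≤ a * k := by
    rw [div_mul_eq_mul_div, div_le_iff₀ hD0]
    have e : a * D = v + b * p ^ 2 := by linarith
    have : a * k * D = k * v + b * p ^ 2 * k := by
      calc a * k * D = k * (a * D) := by ring
        _ = _ := by rw [e]; ring
    rw [this, ← hσk]
    -- Here `τ ≤ σ ≤ 1/2` absorbs the factor `2`; the remaining terms compare by `τ ≤ σ = k v`.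
    have h2 : 2 * τ * (b * p ^ 2 * k) ≤ 1 * (b * p ^ 2 * k) :=
      mul_le_mul_of_nonneg_right (by linarith) (by positivity)
    nlinarith
  have h2 : a * (a * k) ≤ (1 + 2 * (b * p ^ 2) * k)
      * (k * (a - 2 * b * p * y) ^ 2 + 2 * b * y ^ 2) := by
    -- This square is exactly the difference of the two sides of `h2`.
    have : 0 ≤ 2 * b * (y - k * (a - 2 * b * p * y) * p) ^ 2 := by positivity
    nlinarith [this]
  have h3 : (1 + 2 * (b * p ^ 2) * k) * (a * (τ / D)) ≤ (1 + 2 * (b * p ^ 2) * k)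
      * (k * (a - 2 * b * p * y) ^ 2 + 2 * b * y ^ 2) := by
    refine le_trans ?_ h2
    have := mul_le_mul_of_nonneg_left h1 ha
    linarith
  exact le_of_mul_le_mul_left h3 (by positivity)

/-- Concavity along a curve `p = α + β φ(D)`, where `φ = detEntropy`, of `φ (a D - b p²)` as a
function of `φ(D)`. -/
lemma detEntropy_two_point {D₁ D₂ D a b α β s t : ℝ} (h1 : 0 < D₁) (h2 : D₂ < 1 / 4)
    (h1D : D₁ < D) (hD2 : D < D₂) (ha : 0 ≤ a) (hb : 0 ≤ b)
    (hmem : ∀ x ∈ Icc D₁ D₂, x ≤ a * x - b * (α + β * detEntropy x) ^ 2 ∧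
      a * x - b * (α + β * detEntropy x) ^ 2 < 1 / 4)
    (hs : 0 ≤ s) (ht : 0 ≤ t) (hst : s + t = 1)
    (hD : detEntropy D = s * detEntropy D₁ + t * detEntropy D₂) :
    s * detEntropy (a * D₁ - b * (α + β * detEntropy D₁) ^ 2)
        + t * detEntropy (a * D₂ - b * (α + β * detEntropy D₂) ^ 2)
      ≤ detEntropy (a * D - b * (α + β * detEntropy D) ^ 2) := by
  set p : ℝ → ℝ := fun x => α + β * detEntropy x with hp
  set v : ℝ → ℝ := fun x => a * x - b * p x ^ 2 with hv
  -- `R` is the slope of the output entropy with respect to the environment entropy along the curve.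
  set R : ℝ → ℝ := fun x =>
    detEntropyDeriv (v x) * (a / detEntropyDeriv x - 2 * b * β * p x) with hR
  have hx : ∀ x ∈ Icc D₁ D₂, x ∈ Ioo (0 : ℝ) (1 / 4) :=
    fun x hx => ⟨h1.trans_le hx.1, hx.2.trans_lt h2⟩
  have hvx : ∀ x ∈ Icc D₁ D₂, v x ∈ Ioo (0 : ℝ) (1 / 4) :=
    fun x hx' => ⟨(hx x hx').1.trans_le (hmem x hx').1, (hmem x hx').2⟩
  have hp' : ∀ x ∈ Icc D₁ D₂, HasDerivAt p (β * detEntropyDeriv x) x := fun x hx' =>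
    ((hasDerivAt_detEntropy (hx x hx')).const_mul β).const_add α
  have hv' : ∀ x ∈ Icc D₁ D₂,
      HasDerivAt v (a - 2 * b * p x * (β * detEntropyDeriv x)) x := fun x hx' =>
    (((hasDerivAt_id x).const_mul a).sub (((hp' x hx').fun_pow 2).const_mul b)).congr_deriv
      (by push_cast; ring)
  have hf' : ∀ x ∈ Icc D₁ D₂,
      HasDerivAt (fun x => detEntropy (v x)) (detEntropyDeriv x * R x) x := fun x hx' => by
    refine ((hasDerivAt_detEntropy (hvx x hx')).comp x (hv' x hx')).congr_deriv ?_
    have := detEntropyDeriv_pos (hx x hx')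
    simp only [hR]
    field_simp
  have hR' : ∀ x ∈ Icc D₁ D₂, HasDerivAt R
      (detEntropyDeriv (v x) / detEntropyDeriv x * (a * (elasticity √(1 - 4 * x) / x)
        - (elasticity √(1 - 4 * v x) / v x * (a - 2 * b * p x * (β * detEntropyDeriv x)) ^ 2
          + 2 * b * (β * detEntropyDeriv x) ^ 2))) x := fun x hx' => by
    have h0 := detEntropyDeriv_pos (hx x hx')
    have hda : HasDerivAt (fun x => a / detEntropyDeriv x) _ x :=
      (hasDerivAt_const x a).div (hasDerivAt_detEntropyDeriv (hx x hx')) h0.ne'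
    refine (((hasDerivAt_detEntropyDeriv (hvx x hx')).comp x (hv' x hx')).mul
      (hda.sub ((hp' x hx').const_mul (2 * b * β)))).congr_deriv ?_
    simp only [Function.comp, Pi.sub_apply]
    generalize elasticity √(1 - 4 * x) / x = c
    generalize elasticity √(1 - 4 * v x) / v x = c'
    field_simp
    ring
  have hanti : AntitoneOn R (Icc D₁ D₂) := by
    apply antitoneOn_of_deriv_nonpos (convex_Icc _ _)
    · exact fun x hx' => (hR' x hx').continuousAt.continuousWithinAt
    · exact fun x hx' =>
        (hR' x (interior_subset hx')).differentiableAt.differentiableWithinAt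
    · intro x hx'
      have hx'' := interior_subset hx'
      rw [(hR' x hx'').deriv]
      apply mul_nonpos_of_nonneg_of_nonpos
      · exact (div_pos (detEntropyDeriv_pos (hvx x hx'')) (detEntropyDeriv_pos (hx x hx''))).le
      · rw [sub_nonpos]
        -- Applied with `y = β φ'(x)`, the velocity of `p` in the parameter `x`.
        exact mul_elasticity_le (hx x hx'') (hvx x hx'') (hmem x hx'').1 ha hb rfl
  -- Cauchy's mean value theorem: a chord slope in the environment entropy is a value of `R`, so the
  -- inverse of `φ` never has to be differentiated.
  have mvt : ∀ x ∈ Icc D₁ D₂, ∀ y ∈ Icc D₁ D₂, x < y → ∃ c ∈ Ioo x y,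
      detEntropy (v y) - detEntropy (v x) = (detEntropy y - detEntropy x) * R c := by
    intro x hx1 y hy1 hxy
    have hsub : Icc x y ⊆ Icc D₁ D₂ := Icc_subset_Icc hx1.1 hy1.2
    obtain ⟨c, hc, he⟩ := exists_ratio_hasDerivAt_eq_ratio_slope (fun x => detEntropy (v x))
      (fun x => detEntropyDeriv x * R x) hxy
      (fun z hz => (hf' z (hsub hz)).continuousAt.continuousWithinAt)
      (fun z hz => hf' z (hsub (Ioo_subset_Icc_self hz)))
      detEntropy detEntropyDeriv continuous_detEntropy.continuousOn
      (fun z hz => hasDerivAt_detEntropy (hx z (hsub (Ioo_subset_Icc_self hz))))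
    refine ⟨c, hc, ?_⟩
    have h0 := detEntropyDeriv_pos (hx c (hsub (Ioo_subset_Icc_self hc)))
    apply mul_right_cancel₀ h0.ne'
    rw [← he]; ring
  have m1 : D₁ ∈ Icc D₁ D₂ := ⟨le_rfl, (h1D.trans hD2).le⟩
  have m2 : D₂ ∈ Icc D₁ D₂ := ⟨(h1D.trans hD2).le, le_rfl⟩
  have mD : D ∈ Icc D₁ D₂ := ⟨h1D.le, hD2.le⟩
  obtain ⟨c₁, hc1, e1⟩ := mvt D₁ m1 D mD h1D
  obtain ⟨c₂, hc2, e2⟩ := mvt D mD D₂ m2 hD2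
  have hRc : R c₂ ≤ R c₁ := hanti ⟨hc1.1.le, (hc1.2.trans hD2).le⟩
    ⟨(h1D.trans hc2.1).le, hc2.2.le⟩ (hc1.2.trans hc2.1).le
  have hlt : detEntropy D₁ ≤ detEntropy D₂ :=
    strictMonoOn_detEntropy.monotoneOn ⟨h1.le, by linarith⟩ ⟨by linarith, h2.le⟩ (by linarith)
  have d1 : detEntropy D - detEntropy D₁ = t * (detEntropy D₂ - detEntropy D₁) := by
    rw [hD]; linear_combination (detEntropy D₁) * hst
  have d2 : detEntropy D₂ - detEntropy D = s * (detEntropy D₂ - detEntropy D₁) := by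
    rw [hD]; linear_combination (-detEntropy D₂) * hst
  rw [d1] at e1
  rw [d2] at e2
  change s * detEntropy (v D₁) + t * detEntropy (v D₂) ≤ detEntropy (v D)
  have h3 : 0 ≤ s * t * (detEntropy D₂ - detEntropy D₁) * (R c₁ - R c₂) :=
    mul_nonneg (mul_nonneg (mul_nonneg hs ht) (by linarith)) (by linarith)
  have h4 : detEntropy (v D) = s * detEntropy (v D) + t * detEntropy (v D) := by
    rw [← add_mul, hst, one_mul]
  nlinarith [congrArg (s * ·) e1, congrArg (t * ·) e2]

/-- Concavity of `(p, u) ↦ φ (a φ⁻¹(u) - b p²)`, where `φ = detEntropy`, along a segment with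
distinct `u`. -/
lemma detEntropy_segment {a b D₁ D₂ p₁ p₂ s t : ℝ} (ha : 0 ≤ a) (hb : 0 ≤ b)
    (h1 : 0 < D₁) (h2 : D₂ < 1 / 4) (h12 : D₁ < D₂) (hs : 0 < s) (ht : 0 < t) (hst : s + t = 1)
    (dom : ∀ D x y : ℝ, D ∈ Icc (0 : ℝ) (1 / 4) → 0 ≤ x → 0 ≤ y → x + y = 1 →
      detEntropy D = x * detEntropy D₁ + y * detEntropy D₂ →
      D ≤ a * D - b * (x * p₁ + y * p₂) ^ 2 ∧ a * D - b * (x * p₁ + y * p₂) ^ 2 < 1 / 4)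
    {D : ℝ} (hD : D ∈ Icc (0 : ℝ) (1 / 4))
    (hDe : detEntropy D = s * detEntropy D₁ + t * detEntropy D₂) :
    s * detEntropy (a * D₁ - b * p₁ ^ 2) + t * detEntropy (a * D₂ - b * p₂ ^ 2)
      ≤ detEntropy (a * D - b * (s * p₁ + t * p₂) ^ 2) := by
  have m1 : D₁ ∈ Icc (0 : ℝ) (1 / 4) := ⟨h1.le, by linarith⟩
  have m2 : D₂ ∈ Icc (0 : ℝ) (1 / 4) := ⟨by linarith, h2.le⟩
  have hφ := strictMonoOn_detEntropy m1 m2 h12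
  set Δ := detEntropy D₂ - detEntropy D₁ with hΔ
  have hΔ0 : 0 < Δ := by linarith
  have hs' : s = 1 - t := by linarith
  have hD1 : D₁ < D := (strictMonoOn_detEntropy.lt_iff_lt m1 hD).1 (by
    rw [hDe, hs']; nlinarith)
  have hD2 : D < D₂ := (strictMonoOn_detEntropy.lt_iff_lt hD m2).1 (by
    have : t = 1 - s := by linarith
    rw [hDe, this]; nlinarith)
  -- On the segment `p` is affine in the environment entropy; `α` and `β` are the coefficients of
  -- the affine function through the two end points.
  set β := (p₂ - p₁) / Δ with hβ
  set α := p₁ - β * detEntropy D₁ with hα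
  have hβΔ : β * Δ = p₂ - p₁ := by rw [hβ]; field_simp
  have key := detEntropy_two_point (α := α) (β := β) h1 h2 hD1 hD2 ha hb ?_ hs.le ht.le hst hDe
  · have e1 : α + β * detEntropy D₁ = p₁ := by rw [hα]; ring
    have e2 : α + β * detEntropy D₂ = p₂ := by
      rw [hα]; linear_combination hβΔ
    have e3 : α + β * detEntropy D = s * p₁ + t * p₂ := by
      rw [hDe, hα, hs']; linear_combination t * hβΔ
    rwa [e1, e2, e3] at key
  · intro x hx
    have mx : x ∈ Icc (0 : ℝ) (1 / 4) := ⟨by linarith [hx.1], by linarith [hx.2]⟩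
    have g1 := strictMonoOn_detEntropy.monotoneOn m1 mx hx.1
    have g2 := strictMonoOn_detEntropy.monotoneOn mx m2 hx.2
    set y := (detEntropy x - detEntropy D₁) / Δ with hy
    have hyΔ : y * Δ = detEntropy x - detEntropy D₁ := by rw [hy]; field_simp
    have hy0 : 0 ≤ y := div_nonneg (by linarith) hΔ0.le
    have hy1 : y ≤ 1 := (div_le_one hΔ0).2 (by linarith)
    have := dom x (1 - y) y mx (by linarith) hy0 (by ring) (by linear_combination -hyΔ)
    have e : α + β * detEntropy x = (1 - y) * p₁ + y * p₂ := by
      have : detEntropy x = detEntropy D₁ + y * Δ := by linarith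
      rw [hα, this]; linear_combination y * hβΔ
    rw [e]; exact this

/-! ### Output and environment determinants -/

/-- The determinant of the output of the amplitude damping channel of transmissivity `z` on a
qubit state with excited population `p` and relative coherence `ν`. -/
def outDet (z p ν : ℝ) : ℝ := z * p * (1 - z * p) - z * ν ^ 2 * p * (1 - p)

lemma outDet_ge {z p ν : ℝ} (hz : 0 ≤ z) (hp : p ∈ Icc (0 : ℝ) 1) (hν : ν ∈ Icc (0 : ℝ) 1) :
    z * (1 - z) * p ^ 2 ≤ outDet z p ν := by
  have : 0 ≤ z * p * (1 - p) * (1 - ν ^ 2) :=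
    mul_nonneg (mul_nonneg (mul_nonneg hz hp.1) (by linarith [hp.2]))
      (by nlinarith [hν.1, hν.2])
  rw [outDet]; nlinarith

lemma outDet_le {z p ν : ℝ} (hz : 0 ≤ z) (hp : p ∈ Icc (0 : ℝ) 1) :
    outDet z p ν ≤ z * p * (1 - z * p) := by
  have : 0 ≤ z * ν ^ 2 * p * (1 - p) :=
    mul_nonneg (mul_nonneg (mul_nonneg hz (sq_nonneg ν)) hp.1) (by linarith [hp.2])
  rw [outDet]; linarith

lemma mul_one_sub_le_quarter (y : ℝ) : y * (1 - y) ≤ 1 / 4 := by nlinarith [sq_nonneg (1 - 2 * y)]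

lemma outDet_mem {z p ν : ℝ} (hz : z ∈ Icc (0 : ℝ) 1) (hp : p ∈ Icc (0 : ℝ) 1)
    (hν : ν ∈ Icc (0 : ℝ) 1) : outDet z p ν ∈ Icc (0 : ℝ) (1 / 4) :=
  ⟨le_trans (mul_nonneg (mul_nonneg hz.1 (by linarith [hz.2])) (sq_nonneg p))
    (outDet_ge hz.1 hp hν), (outDet_le hz.1 hp).trans (mul_one_sub_le_quarter _)⟩

/-- The coherence term is proportional to the transmissivity, so rescaling by `η / z` cancels it and
leaves only a multiple of `p²`. -/
lemma outDet_eq_sub {η z p ν : ℝ} (hz : z ≠ 0) (h : η + z = 1) :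
    outDet η p ν = η / z * outDet z p ν - η * (2 * η - 1) * p ^ 2 := by
  obtain rfl : η = 1 - z := by linarith
  rw [outDet, outDet]; field_simp; ring

/-- For every population and environment entropy within the bounds there is a coherence. -/
lemma exists_coherence {z p u : ℝ} (hl : detEntropy (z * (1 - z) * p ^ 2) ≤ u)
    (hu : u ≤ detEntropy (z * p * (1 - z * p))) :
    ∃ ν ∈ Icc (0 : ℝ) 1, detEntropy (outDet z p ν) = u := by
  have hc : ContinuousOn (fun ν => detEntropy (outDet z p ν)) (Icc 0 1) := by
    apply (continuous_detEntropy.comp _).continuousOn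
    unfold outDet; fun_prop
  -- The determinant is largest at `ν = 0` and smallest at `ν = 1`, hence the order-reversing form
  -- of the intermediate value theorem.
  have h0 : outDet z p 0 = z * p * (1 - z * p) := by rw [outDet]; ring
  have h1 : outDet z p 1 = z * (1 - z) * p ^ 2 := by rw [outDet]; ring
  have := intermediate_value_Icc' (zero_le_one (α := ℝ)) hc
  simp only [h0, h1] at this
  exact this ⟨hl, hu⟩

lemma concaveOn_binEntropy_mul {z : ℝ} (hz : z ∈ Icc (0 : ℝ) 1) :
    ConcaveOn ℝ (Icc 0 1) fun p => Real.binEntropy (z * p) := by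
  refine ⟨convex_Icc _ _, fun x hx y hy s t hs ht hst => ?_⟩
  have hm : ∀ x ∈ Icc (0 : ℝ) 1, z * x ∈ Icc (0 : ℝ) 1 := fun x hx =>
    ⟨mul_nonneg hz.1 hx.1, mul_le_one₀ hz.2 hx.1 hx.2⟩
  have := Real.strictConcave_binEntropy.concaveOn.2 (hm x hx) (hm y hy) hs ht hst
  simp only [smul_eq_mul] at this ⊢
  convert this using 2; ring

/-- The two-point inequality away from the boundary of the parameter square. -/
lemma exists_coherence_two_point_interior {η z p₁ p₂ ν₁ ν₂ s t : ℝ} (hη : 1 / 2 ≤ η) (hz : 0 < z)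
    (hηz : η + z = 1) (hp1 : p₁ ∈ Ioo (0 : ℝ) 1) (hp2 : p₂ ∈ Ioo (0 : ℝ) 1)
    (hν1 : ν₁ ∈ Ioc (0 : ℝ) 1) (hν2 : ν₂ ∈ Ioc (0 : ℝ) 1)
    (hs : 0 ≤ s) (ht : 0 ≤ t) (hst : s + t = 1) :
    ∃ ν ∈ Icc (0 : ℝ) 1,
      detEntropy (outDet z (s * p₁ + t * p₂) ν)
        = s * detEntropy (outDet z p₁ ν₁) + t * detEntropy (outDet z p₂ ν₂) ∧
      s * detEntropy (outDet η p₁ ν₁) + t * detEntropy (outDet η p₂ ν₂)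
        ≤ detEntropy (outDet η (s * p₁ + t * p₂) ν) := by
  have hzI : z ∈ Icc (0 : ℝ) 1 := ⟨hz.le, by linarith⟩
  have hηI : η ∈ Icc (0 : ℝ) 1 := ⟨by linarith, by linarith⟩
  have hθ : z * (1 - z) ≤ 1 / 4 := mul_one_sub_le_quarter z
  have hθ0 : 0 < z * (1 - z) := mul_pos hz (by linarith)
  have hconv := convexOn_detEntropy_sq hθ0.le hθ
  have hconc := concaveOn_binEntropy_mul hzI
  have hpI : ∀ x y : ℝ, 0 ≤ x → 0 ≤ y → x + y = 1 → x * p₁ + y * p₂ ∈ Ioo (0 : ℝ) 1 :=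
    fun x y hx hy hxy => by
      have := (convex_Ioo (0 : ℝ) 1) hp1 hp2 hx hy hxy
      simpa using this
  -- the bounds on the environment entropy, at the end points and then on the segment
  have bnd : ∀ p ν : ℝ, p ∈ Ioo (0 : ℝ) 1 → ν ∈ Ioc (0 : ℝ) 1 →
      detEntropy (z * (1 - z) * p ^ 2) ≤ detEntropy (outDet z p ν) ∧
      detEntropy (outDet z p ν) < Real.binEntropy (z * p) := by
    intro p ν hp hν
    have hp' := Ioo_subset_Icc_self hp
    have hν' := Ioc_subset_Icc_self hν
    have hm := outDet_mem hzI hp' hν'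
    have hge := outDet_ge hz.le hp' hν'
    refine ⟨strictMonoOn_detEntropy.monotoneOn
      ⟨by positivity, hge.trans hm.2⟩ hm hge, ?_⟩
    rw [← detEntropy_mul_one_sub]
    -- Strictness needs `ν > 0`; it is what later keeps output determinants below `1/4`, where `φ`
    -- is differentiable.
    have hlt : outDet z p ν < z * p * (1 - z * p) := by
      have : 0 < z * ν ^ 2 * p * (1 - p) :=
        mul_pos (mul_pos (mul_pos hz (pow_pos hν.1 2)) hp.1) (by linarith [hp.2])
      rw [outDet]; linarith
    exact strictMonoOn_detEntropy hm ⟨hm.1.trans hlt.le, mul_one_sub_le_quarter _⟩ hlt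
  obtain ⟨l1, r1⟩ := bnd p₁ ν₁ hp1 hν1
  obtain ⟨l2, r2⟩ := bnd p₂ ν₂ hp2 hν2
  have hD1m := outDet_mem hzI (Ioo_subset_Icc_self hp1) (Ioc_subset_Icc_self hν1)
  have hD2m := outDet_mem hzI (Ioo_subset_Icc_self hp2) (Ioc_subset_Icc_self hν2)
  have seg : ∀ x y : ℝ, 0 ≤ x → 0 ≤ y → x + y = 1 →
      detEntropy (z * (1 - z) * (x * p₁ + y * p₂) ^ 2)
        ≤ x * detEntropy (outDet z p₁ ν₁) + y * detEntropy (outDet z p₂ ν₂) ∧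
      x * detEntropy (outDet z p₁ ν₁) + y * detEntropy (outDet z p₂ ν₂)
        < Real.binEntropy (z * (x * p₁ + y * p₂)) := by
    intro x y hx hy hxy
    -- The admissible entropies at population `p` lie between a convex and a concave function of
    -- `p`, so the domain is convex.
    have c1 := hconv.2 (Ioo_subset_Icc_self hp1) (Ioo_subset_Icc_self hp2) hx hy hxy
    have c2 := hconc.2 (Ioo_subset_Icc_self hp1) (Ioo_subset_Icc_self hp2) hx hy hxy
    simp only [smul_eq_mul] at c1 c2
    have a1 := mul_le_mul_of_nonneg_left l1 hx
    have a2 := mul_le_mul_of_nonneg_left l2 hy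
    refine ⟨by linarith, lt_of_lt_of_le ?_ c2⟩
    rcases hx.eq_or_lt with rfl | hx'
    · have : y = 1 := by linarith
      subst this; simpa using r2
    · have b1 := mul_lt_mul_of_pos_left r1 hx'
      have b2 := mul_le_mul_of_nonneg_left r2.le hy
      linarith
  -- a point of the segment with environment determinant `D` has output determinant in `[D, 1/4)`
  have dom : ∀ D x y : ℝ, D ∈ Icc (0 : ℝ) (1 / 4) → 0 ≤ x → 0 ≤ y → x + y = 1 →
      detEntropy D = x * detEntropy (outDet z p₁ ν₁) + y * detEntropy (outDet z p₂ ν₂) →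
      D ≤ η / z * D - η * (2 * η - 1) * (x * p₁ + y * p₂) ^ 2 ∧
      η / z * D - η * (2 * η - 1) * (x * p₁ + y * p₂) ^ 2 < 1 / 4 := by
    intro D x y hD hx hy hxy hDu
    obtain ⟨s1, s2⟩ := seg x y hx hy hxy
    have hp := hpI x y hx hy hxy
    generalize x * p₁ + y * p₂ = p at *
    rw [← hDu] at s1 s2
    rw [← detEntropy_mul_one_sub] at s2
    have hpp : p ^ 2 ≤ 1 := by nlinarith [hp.1, hp.2]
    have t1 : z * (1 - z) * p ^ 2 ≤ D := (strictMonoOn_detEntropy.le_iff_le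
      ⟨by positivity, by nlinarith⟩ hD).1 s1
    have hzp : z * p ≤ 1 := by nlinarith [hp.1, hp.2]
    have t2 : D < z * p * (1 - z * p) := (strictMonoOn_detEntropy.lt_iff_lt hD
      ⟨mul_nonneg (mul_nonneg hz.le hp.1.le) (by linarith), mul_one_sub_le_quarter _⟩).1 s2
    have hηe : η = 1 - z := by linarith
    constructor
    -- The hypothesis `1/2 ≤ η` makes the output determinant at least the environment determinant,
    -- as the monotonicity of the elasticity requires.
    · have : η / z * D - η * (2 * η - 1) * p ^ 2 - D
          = (2 * η - 1) / z * (D - z * (1 - z) * p ^ 2) := by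
        rw [hηe]; field_simp; ring
      have : 0 ≤ (2 * η - 1) / z * (D - z * (1 - z) * p ^ 2) :=
        mul_nonneg (div_nonneg (by linarith) hz.le) (by linarith)
      linarith
    · have h1 : η / z * D < η / z * (z * p * (1 - z * p)) :=
        mul_lt_mul_of_pos_left t2 (div_pos (by linarith) hz)
      have h2 : η / z * (z * p * (1 - z * p)) - η * (2 * η - 1) * p ^ 2
          = η * p * (1 - η * p) := by
        rw [hηe]; field_simp; ring
      have h3 := mul_one_sub_le_quarter (η * p)
      linarith
  obtain ⟨ν, hν, hνe⟩ := exists_coherence (seg s t hs ht hst).1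
    (by rw [detEntropy_mul_one_sub]; exact (seg s t hs ht hst).2.le)
  refine ⟨ν, hν, hνe, ?_⟩
  have hDm := outDet_mem hzI (Ioo_subset_Icc_self (hpI s t hs ht hst)) hν
  rw [outDet_eq_sub hz.ne' hηz, outDet_eq_sub hz.ne' hηz, outDet_eq_sub hz.ne' hηz]
  set D₁ := outDet z p₁ ν₁ with hD₁
  set D₂ := outDet z p₂ ν₂ with hD₂
  set D := outDet z (s * p₁ + t * p₂) ν with hDdef
  have ha : 0 ≤ η / z := div_nonneg (by linarith) hz.le
  have hb : 0 ≤ η * (2 * η - 1) := mul_nonneg (by linarith) (by linarith)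
  have D1pos : 0 < D₁ := lt_of_lt_of_le (by have := hp1.1; positivity)
    (outDet_ge hz.le (Ioo_subset_Icc_self hp1) (Ioc_subset_Icc_self hν1))
  have D2pos : 0 < D₂ := lt_of_lt_of_le (by have := hp2.1; positivity)
    (outDet_ge hz.le (Ioo_subset_Icc_self hp2) (Ioc_subset_Icc_self hν2))
  have dom1 := dom D₁ 1 0 hD1m zero_le_one le_rfl (by ring) (by ring)
  have dom2 := dom D₂ 0 1 hD2m le_rfl zero_le_one (by ring) (by ring)
  have D1lt : D₁ < 1 / 4 := dom1.1.trans_lt dom1.2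
  have D2lt : D₂ < 1 / 4 := dom2.1.trans_lt dom2.2
  rcases hs.eq_or_lt with rfl | hs'
  · obtain rfl : t = 1 := by linarith
    have : D = D₂ := strictMonoOn_detEntropy.injOn hDm hD2m (by rw [hνe]; ring)
    simp [this]
  rcases ht.eq_or_lt with rfl | ht'
  · obtain rfl : s = 1 := by linarith
    have : D = D₁ := strictMonoOn_detEntropy.injOn hDm hD1m (by rw [hνe]; ring)
    simp [this]
  rcases lt_trichotomy D₁ D₂ with h | h | h
  · exact detEntropy_segment ha hb D1pos D2lt h hs' ht' hst dom hDm hνe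
  -- With equal environment entropies the segment cannot be parametrised by entropy. Concavity
  -- follows instead from that of `φ` and of `-b p²`.
  · have hDD : D = D₁ := strictMonoOn_detEntropy.injOn hDm hD1m (by
      rw [hνe, ← h, ← add_mul, hst, one_mul])
    rw [← h] at dom2 ⊢
    rw [hDD]
    set a := η / z
    set b := η * (2 * η - 1)
    simp only [one_mul, zero_mul, add_zero, zero_add] at dom1 dom2
    have w1 : a * D₁ - b * p₁ ^ 2 ∈ Icc (0 : ℝ) (1 / 4) := ⟨by linarith [dom1.1], dom1.2.le⟩
    have w2 : a * D₁ - b * p₂ ^ 2 ∈ Icc (0 : ℝ) (1 / 4) := ⟨by linarith [dom2.1], dom2.2.le⟩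
    have c := concaveOn_detEntropy.2 w1 w2 hs ht hst
    have wc := (convex_Icc (0 : ℝ) (1 / 4)) w1 w2 hs ht hst
    simp only [smul_eq_mul] at c wc
    refine c.trans (strictMonoOn_detEntropy.monotoneOn wc ?_ ?_)
    · have := dom D₁ s t hD1m hs ht hst (by rw [hDD] at hνe; exact hνe)
      exact ⟨by linarith [this.1], this.2.le⟩
    · have e : s * (a * D₁ - b * p₁ ^ 2) + t * (a * D₁ - b * p₂ ^ 2)
          = a * D₁ - b * (s * p₁ + t * p₂) ^ 2 - b * (s * t * (p₁ - p₂) ^ 2) := by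
        obtain rfl : s = 1 - t := by linarith
        ring
      have : 0 ≤ b * (s * t * (p₁ - p₂) ^ 2) := by positivity
      linarith
  · have := detEntropy_segment ha hb D2pos D1lt h ht' hs' (by linarith)
      (fun D x y hD hx hy hxy hDe => by
        have := dom D y x hD hy hx (by linarith) (by linarith)
        rwa [add_comm (y * p₁)] at this) hDm (by linarith)
    rw [add_comm (s * p₁), add_comm (s * _)]
    exact this

lemma tendsto_detEntropy_outDet (w : ℝ) {a b : ℕ → ℝ} {a' b' : ℝ}
    (ha : Tendsto a atTop (𝓝 a')) (hb : Tendsto b atTop (𝓝 b')) :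
    Tendsto (fun n => detEntropy (outDet w (a n) (b n))) atTop
      (𝓝 (detEntropy (outDet w a' b'))) := by
  refine (continuous_detEntropy.tendsto _).comp ?_
  unfold outDet
  exact ((ha.const_mul w).mul ((ha.const_mul w).const_sub 1)).sub
    ((((hb.pow 2).const_mul w).mul ha).mul (ha.const_sub 1))

/-- The two-point inequality: mixing two inputs, there is an input with the average population
and the average environment entropy whose output entropy is at least the average one. -/
lemma exists_coherence_two_point {η z p₁ p₂ ν₁ ν₂ s t : ℝ} (hη : 1 / 2 ≤ η) (hz : 0 < z)
    (hηz : η + z = 1) (hp1 : p₁ ∈ Icc (0 : ℝ) 1) (hp2 : p₂ ∈ Icc (0 : ℝ) 1)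
    (hν1 : ν₁ ∈ Icc (0 : ℝ) 1) (hν2 : ν₂ ∈ Icc (0 : ℝ) 1)
    (hs : 0 ≤ s) (ht : 0 ≤ t) (hst : s + t = 1) :
    ∃ ν ∈ Icc (0 : ℝ) 1,
      detEntropy (outDet z (s * p₁ + t * p₂) ν)
        = s * detEntropy (outDet z p₁ ν₁) + t * detEntropy (outDet z p₂ ν₂) ∧
      s * detEntropy (outDet η p₁ ν₁) + t * detEntropy (outDet η p₂ ν₂)
        ≤ detEntropy (outDet η (s * p₁ + t * p₂) ν) := by
  have hPseq : ∀ p ∈ Icc (0 : ℝ) 1, ∃ P : ℕ → ℝ, (∀ n, P n ∈ Ioo (0 : ℝ) 1) ∧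
      Tendsto P atTop (𝓝 p) := fun p hp => by
    rwa [← closure_Ioo zero_ne_one, mem_closure_iff_seq_limit] at hp
  have hNseq : ∀ p ∈ Icc (0 : ℝ) 1, ∃ P : ℕ → ℝ, (∀ n, P n ∈ Ioc (0 : ℝ) 1) ∧
      Tendsto P atTop (𝓝 p) := fun p hp => by
    rwa [← closure_Ioc zero_ne_one, mem_closure_iff_seq_limit] at hp
  obtain ⟨P₁, hP1, hP1t⟩ := hPseq p₁ hp1
  obtain ⟨P₂, hP2, hP2t⟩ := hPseq p₂ hp2
  obtain ⟨N₁, hN1, hN1t⟩ := hNseq ν₁ hν1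
  obtain ⟨N₂, hN2, hN2t⟩ := hNseq ν₂ hν2
  -- Boundary parameters are limits of interior ones; compactness supplies a limiting coherence, and
  -- both relations are closed.
  choose ν hν hE hB using fun n => exists_coherence_two_point_interior hη hz hηz
    (hP1 n) (hP2 n) (hN1 n) (hN2 n) hs ht hst
  obtain ⟨ν', hν', k, hk, hlim⟩ := isCompact_Icc.tendsto_subseq hν
  have hk' := hk.tendsto_atTop
  have hav : Tendsto (fun n => s * P₁ (k n) + t * P₂ (k n)) atTop (𝓝 (s * p₁ + t * p₂)) :=
    ((hP1t.comp hk').const_mul s).add ((hP2t.comp hk').const_mul t)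
  have hmix : ∀ w, Tendsto (fun n => s * detEntropy (outDet w (P₁ (k n)) (N₁ (k n)))
      + t * detEntropy (outDet w (P₂ (k n)) (N₂ (k n)))) atTop
      (𝓝 (s * detEntropy (outDet w p₁ ν₁) + t * detEntropy (outDet w p₂ ν₂))) := fun w =>
    ((tendsto_detEntropy_outDet w (hP1t.comp hk') (hN1t.comp hk')).const_mul s).add
      ((tendsto_detEntropy_outDet w (hP2t.comp hk') (hN2t.comp hk')).const_mul t)
  refine ⟨ν', hν', ?_, ?_⟩
  · exact tendsto_nhds_unique ((tendsto_detEntropy_outDet z hav hlim).congr fun n => hE (k n))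
      (hmix z)
  · exact le_of_tendsto_of_tendsto' (hmix η) (tendsto_detEntropy_outDet η hav hlim)
      fun n => hB (k n)

/-! ### Averaging over finite ensembles -/

/-- The triples of population, environment entropy and achievable output entropy. -/
def hypograph (η z : ℝ) : Set (ℝ × ℝ × ℝ) :=
  {x | x.1 ∈ Icc (0 : ℝ) 1 ∧ ∃ ν ∈ Icc (0 : ℝ) 1,
    detEntropy (outDet z x.1 ν) = x.2.1 ∧ x.2.2 ≤ detEntropy (outDet η x.1 ν)}

/-- This recasts the two-point statement as convexity of a set, which passes to arbitrary finite
averages. The environment entropy is kept as an equality because it enters the two rates with a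
negative sign. -/
lemma convex_hypograph {η z : ℝ} (hη : 1 / 2 ≤ η) (hz : 0 < z) (hηz : η + z = 1) :
    Convex ℝ (hypograph η z) := by
  rintro ⟨p₁, u₁, w₁⟩ ⟨hp1, ν₁, hν1, he1, hw1⟩ ⟨p₂, u₂, w₂⟩ ⟨hp2, ν₂, hν2, he2, hw2⟩ s t hs ht hst
  obtain ⟨ν, hν, hE, hB⟩ := exists_coherence_two_point hη hz hηz hp1 hp2 hν1 hν2 hs ht hst
  dsimp only at he1 he2 hw1 hw2
  refine ⟨by simpa using (convex_Icc (0 : ℝ) 1) hp1 hp2 hs ht hst, ν, hν, ?_, ?_⟩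
  · simp only [Prod.smul_mk, Prod.mk_add_mk, smul_eq_mul, hE, he1, he2]
  · simp only [Prod.smul_mk, Prod.mk_add_mk, smul_eq_mul]
    have := mul_le_mul_of_nonneg_left hw1 hs
    have := mul_le_mul_of_nonneg_left hw2 ht
    linarith

/-- Averaging a finite family of inputs. -/
lemma exists_coherence_sum {ι : Type*} [Fintype ι] {η : ℝ} (hη : 1 / 2 ≤ η) (hη1 : η ≤ 1)
    {q p ν : ι → ℝ} (hq : ∀ i, 0 ≤ q i) (hq1 : ∑ i, q i = 1) (hp : ∀ i, p i ∈ Icc (0 : ℝ) 1)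
    (hν : ∀ i, ν i ∈ Icc (0 : ℝ) 1) :
    ∃ ν' ∈ Icc (0 : ℝ) 1,
      detEntropy (outDet (1 - η) (∑ i, q i * p i) ν')
        = ∑ i, q i * detEntropy (outDet (1 - η) (p i) (ν i)) ∧
      ∑ i, q i * detEntropy (outDet η (p i) (ν i))
        ≤ detEntropy (outDet η (∑ i, q i * p i) ν') := by
  rcases hη1.eq_or_lt with rfl | hlt
  -- At `η = 1` every environment determinant is zero, so `ν' = 0` can be taken to maximise the
  -- output entropy.
  · refine ⟨0, by simp, by simp [outDet, detEntropy], ?_⟩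
    have h0 : outDet 1 (∑ i, q i * p i) 0 = (∑ i, q i * p i) * (1 - ∑ i, q i * p i) := by
      simp [outDet]
    rw [h0, detEntropy_mul_one_sub]
    have hj := Real.strictConcave_binEntropy.concaveOn.le_map_sum (t := Finset.univ) (w := q)
      (p := p) (fun i _ => hq i) hq1 (fun i _ => hp i)
    simp only [smul_eq_mul] at hj
    refine le_trans (Finset.sum_le_sum fun i _ => mul_le_mul_of_nonneg_left ?_ (hq i)) hj
    have h1 : (1 : ℝ) ∈ Icc (0 : ℝ) 1 := by simp
    have hm := outDet_mem h1 (hp i) (hν i)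
    have hle := outDet_le (ν := ν i) zero_le_one (hp i)
    simp only [one_mul] at hle
    rw [← detEntropy_mul_one_sub]
    exact strictMonoOn_detEntropy.monotoneOn hm
      ⟨hm.1.trans hle, mul_one_sub_le_quarter _⟩ hle
  · have hmem := (convex_hypograph (η := η) (z := 1 - η) hη (by linarith) (by ring)).sum_mem
      (t := Finset.univ) (w := q)
      (z := fun i => (p i, detEntropy (outDet (1 - η) (p i) (ν i)),
        detEntropy (outDet η (p i) (ν i)))) (fun i _ => hq i) hq1
      (fun i _ => ⟨hp i, ν i, hν i, rfl, le_rfl⟩)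
    simpa [hypograph, Prod.fst_sum, Prod.snd_sum] using hmem.2

end CQTradeoff

end

noncomputable section

namespace CQTradeoff

open Set Matrix
open scoped ComplexOrder

/-! ### Spectral computation of entropies -/

/-- The summand `-x log₂ x` of the entropy. -/
def entropyTerm (x : ℝ) : ℝ := -(x * Real.logb 2 x)

lemma entropyTerm_zero : entropyTerm 0 = 0 := by simp [entropyTerm]

lemma entropyTerm_mul (x y : ℝ) :
    entropyTerm (x * y) = x * entropyTerm y + y * entropyTerm x := by
  rcases eq_or_ne x 0 with rfl | hx
  · simp [entropyTerm]
  rcases eq_or_ne y 0 with rfl | hy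
  · simp [entropyTerm]
  rw [entropyTerm, entropyTerm, entropyTerm, Real.logb_mul hx hy]
  ring

lemma entropyTerm_add_one_sub (y : ℝ) :
    entropyTerm y + entropyTerm (1 - y) = Real.binEntropy y / Real.log 2 := by
  rw [entropyTerm, entropyTerm, Real.logb, Real.logb, Real.binEntropy, Real.log_inv, Real.log_inv]
  ring

lemma h2_eq_binEntropy_div (y : ℝ) : h2 y = Real.binEntropy y / Real.log 2 := by
  rw [← entropyTerm_add_one_sub, h2, entropyTerm, entropyTerm]; ring

lemma g_eq_detEntropy_div (q z ν : ℝ) : g q z ν = detEntropy (outDet z q ν) / Real.log 2 := by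
  rw [g, h2_eq_binEntropy_div, detEntropy, outDet]
  ring_nf

variable {n : Type*} [Fintype n] [DecidableEq n]

lemma entropy_eq_sum_eigenvalues {ρ : Matrix n n ℂ} (h : ρ.IsHermitian) :
    entropy ρ = ∑ i, entropyTerm (h.eigenvalues i) := by
  rw [entropy, dif_pos h, ← Finset.sum_neg_distrib]; rfl

lemma entropy_eq_sum_roots {ρ : Matrix n n ℂ} (h : ρ.IsHermitian) :
    entropy ρ = (ρ.charpoly.roots.map fun z => entropyTerm z.re).sum := by
  rw [entropy_eq_sum_eigenvalues h, h.roots_charpoly_eq_eigenvalues, Multiset.map_map]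
  rfl

/-- The entropy depends only on the roots of the characteristic polynomial with multiplicity, which
avoids matching the ordering of `eigenvalues`. -/
lemma entropy_of_charpoly {ι : Type*} [Fintype ι] {ρ : Matrix n n ℂ} (h : ρ.IsHermitian)
    (d : ι → ℝ) (hd : ρ.charpoly = ∏ i, (Polynomial.X - Polynomial.C (d i : ℂ))) :
    entropy ρ = ∑ i, entropyTerm (d i) := by
  rw [entropy_eq_sum_roots h, hd, Polynomial.roots_prod _ _
    (Finset.prod_ne_zero_iff.2 fun i _ => Polynomial.X_sub_C_ne_zero _)]
  simp only [Polynomial.roots_X_sub_C, Multiset.bind_singleton, Multiset.map_map]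
  rfl

lemma entropy_diagonal (d : n → ℝ) :
    entropy (diagonal fun i => (d i : ℂ)) = ∑ i, entropyTerm (d i) :=
  entropy_of_charpoly (by
    rw [isHermitian_diagonal_iff]
    intro i
    simp [IsSelfAdjoint]) d (charpoly_diagonal _)

lemma isHermitian_ofReal_smul {m : Type*} {ρ : Matrix m m ℂ} (h : ρ.IsHermitian) (q : ℝ) :
    ((q : ℂ) • ρ).IsHermitian := by
  rw [IsHermitian, conjTranspose_smul, h.eq]; simp

/-- The eigenvalues scale by `q`, and `entropyTerm` obeys a product rule; trace one turns the sum of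
the eigenvalues into the coefficient of `entropyTerm q`. -/
lemma entropy_smul {ρ : Matrix n n ℂ} (h : ρ.IsHermitian) (htr : ρ.trace = 1) (q : ℝ) :
    entropy ((q : ℂ) • ρ) = entropyTerm q + q * entropy ρ := by
  have hc : ((q : ℂ) • ρ).charpoly
      = ∏ i, (Polynomial.X - Polynomial.C ((q * h.eigenvalues i : ℝ) : ℂ)) := by
    conv_lhs => rw [h.spectral_theorem, ← map_smul, Unitary.conjStarAlgAut_apply,
      charpoly_mul_comm, ← mul_assoc]
    rw [Unitary.coe_star_mul_self, one_mul, ← diagonal_smul, charpoly_diagonal]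
    simp
  have hsum : ∑ i, h.eigenvalues i = 1 := by
    have := h.trace_eq_sum_eigenvalues
    rw [htr] at this
    simpa using (congrArg Complex.re this).symm
  rw [entropy_of_charpoly (isHermitian_ofReal_smul h q) _ hc, entropy_eq_sum_eigenvalues h]
  simp only [entropyTerm_mul, Finset.sum_add_distrib, ← Finset.mul_sum, ← Finset.sum_mul, hsum]
  ring

lemma charpoly_blockDiagonal {X : Type*} [Fintype X] [DecidableEq X] (M : X → Matrix n n ℂ) :
    (blockDiagonal M).charpoly = ∏ x, (M x).charpoly := by
  have : charmatrix (blockDiagonal M) = blockDiagonal fun x => charmatrix (M x) := by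
    ext1 ⟨i, x⟩ ⟨j, y⟩
    rcases eq_or_ne x y with rfl | hxy
    · rcases eq_or_ne i j with rfl | hij
      · simp
      · simp [charmatrix_apply_ne, hij]
    · simp [charmatrix_apply_ne, hxy, blockDiagonal_apply_ne]
  rw [charpoly, this, det_blockDiagonal]; rfl

/-- The classical-quantum matrix `∑ₓ q(x) |x⟩⟨x| ⊗ Mₓ`. -/
def cqMatrix {X : Type*} [DecidableEq X] (q : X → ℝ) (M : X → Matrix n n ℂ) :
    Matrix (X × n) (X × n) ℂ :=
  Matrix.of fun i j => if i.1 = j.1 then (q i.1 : ℂ) * M i.1 i.2 j.2 else 0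

/-- The spectrum of a block diagonal matrix is the union of those of its blocks. The resulting
`H(X)` term cancels from all the rates. -/
lemma entropy_cqMatrix {X : Type*} [Fintype X] [DecidableEq X] (q : X → ℝ)
    {M : X → Matrix n n ℂ} (hM : ∀ x, (M x).IsHermitian) (htr : ∀ x, (M x).trace = 1) :
    entropy (cqMatrix q M) = ∑ x, entropyTerm (q x) + ∑ x, q x * entropy (M x) := by
  have e : cqMatrix q M = reindex (Equiv.prodComm n X) (Equiv.prodComm n X)
      (blockDiagonal fun x => (q x : ℂ) • M x) := by
    ext ⟨x, i⟩ ⟨y, j⟩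
    simp [cqMatrix, blockDiagonal_apply]
  have hH : (cqMatrix q M).IsHermitian := by
    ext ⟨x, i⟩ ⟨y, j⟩
    rcases eq_or_ne x y with rfl | hxy
    · simp [cqMatrix, ← (hM x).apply i j]
    · simp [cqMatrix, hxy, hxy.symm]
  have hne : ∏ x, ((q x : ℂ) • M x).charpoly ≠ 0 :=
    Finset.prod_ne_zero_iff.2 fun x _ => (charpoly_monic _).ne_zero
  rw [entropy_eq_sum_roots hH, e, charpoly_reindex, charpoly_blockDiagonal,
    Polynomial.roots_prod _ _ hne, Multiset.map_bind, Multiset.sum_bind, ← Finset.sum_add_distrib]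
  refine Finset.sum_congr rfl fun x _ => ?_
  rw [← entropy_smul (hM x) (htr x), entropy_eq_sum_roots (isHermitian_ofReal_smul (hM x) (q x))]

/-- The two products have the same nonzero spectrum, and zero eigenvalues contribute nothing. This
is the equality of the two marginal entropies of a pure state. -/
lemma entropy_mul_conjTranspose {m : Type*} [Fintype m] [DecidableEq m] (V : Matrix m n ℂ) :
    entropy (V * Vᴴ) = entropy (Vᴴ * V) := by
  rw [entropy_eq_sum_roots (isHermitian_mul_conjTranspose_self V),
    entropy_eq_sum_roots (isHermitian_conjTranspose_mul_self V)]
  have key := congrArg (fun p : Polynomial ℂ => (p.roots.map fun z => entropyTerm z.re).sum)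
    (charpoly_mul_comm' V Vᴴ)
  have hX : ∀ k : ℕ, (Polynomial.X ^ k : Polynomial ℂ) ≠ 0 := fun k =>
    pow_ne_zero k Polynomial.X_ne_zero
  simp only [Polynomial.roots_mul (mul_ne_zero (hX _) (charpoly_monic _).ne_zero),
    Polynomial.roots_X_pow] at key
  simpa [Multiset.nsmul_singleton, entropyTerm_zero] using key

lemma entropy_qubit {ρ : Matrix (Fin 2) (Fin 2) ℂ} (h : ρ.IsHermitian) (htr : ρ.trace = 1)
    {D : ℝ} (hdet : ρ.det = D) : entropy ρ = detEntropy D / Real.log 2 := by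
  have h1 := h.trace_eq_sum_eigenvalues
  have h2 := h.det_eq_prod_eigenvalues
  rw [htr, Fin.sum_univ_two] at h1
  rw [hdet, Fin.prod_univ_two] at h2
  have h1' : h.eigenvalues 1 = 1 - h.eigenvalues 0 := by
    have : (1 : ℝ) = h.eigenvalues 0 + h.eigenvalues 1 := by simpa using congrArg Complex.re h1
    linarith
  have h2' : D = h.eigenvalues 0 * h.eigenvalues 1 := by simpa using congrArg Complex.re h2
  rw [entropy_eq_sum_eigenvalues h, Fin.sum_univ_two, h2', h1', entropyTerm_add_one_sub,
    detEntropy_mul_one_sub]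

/-! ### Qubit states -/

/-- The qubit matrix with excited population `p` and coherence `c`. -/
def qubit (p : ℝ) (c : ℂ) : Matrix (Fin 2) (Fin 2) ℂ :=
  !![((1 - p : ℝ) : ℂ), c; star c, (p : ℂ)]

lemma exists_eq_qubit {ρ : Matrix (Fin 2) (Fin 2) ℂ} (h : ρ.PosSemidef) (htr : ρ.trace = 1) :
    ∃ p ∈ Icc (0 : ℝ) 1, ∃ ν ∈ Icc (0 : ℝ) 1, ∃ c : ℂ,
      ρ = qubit p c ∧ ‖c‖ ^ 2 = ν ^ 2 * p * (1 - p) := by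
  have hre : ∀ i, ((ρ i i).re : ℂ) = ρ i i := fun i => h.isHermitian.coe_re_apply_self i
  have htr' : (ρ 0 0).re + (ρ 1 1).re = 1 := by
    rw [trace_fin_two] at htr
    simpa using congrArg Complex.re htr
  have hd : ∀ i, 0 ≤ (ρ i i).re := fun i => by
    have := h.diag_nonneg (i := i)
    exact (Complex.le_def.1 this).1
  have hρ : ρ = qubit (ρ 1 1).re (ρ 0 1) := by
    ext i j
    fin_cases i <;> fin_cases j
    · simp only [qubit, Fin.zero_eta, of_apply, cons_val_zero, cons_val', cons_val_fin_one]
      rw [← htr', add_sub_cancel_right, hre]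
    · simp [qubit]
    · simpa [qubit] using (h.isHermitian.apply 1 0).symm
    · simpa [qubit] using (hre 1).symm
  have hdet : ‖ρ 0 1‖ ^ 2 ≤ (ρ 1 1).re * (1 - (ρ 1 1).re) := by
    have h0 := h.det_nonneg
    rw [hρ, det_fin_two] at h0
    have h1 := (Complex.le_def.1 h0).1
    have h2 : (ρ 0 1 * star (ρ 0 1)).re = ‖ρ 0 1‖ ^ 2 := by
      rw [← starRingEnd_apply, Complex.mul_conj, Complex.normSq_eq_norm_sq, Complex.ofReal_re]
    simp only [qubit, of_apply, cons_val', cons_val_zero, cons_val_one, cons_val_fin_one,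
      Complex.sub_re, h2, Complex.zero_re] at h1
    rw [← Complex.ofReal_mul, Complex.ofReal_re] at h1
    linarith
  set p := (ρ 1 1).re
  have hp1 : p ≤ 1 := by linarith [hd 0]
  have hp0 : 0 ≤ p := hd 1
  have hpp : 0 ≤ p * (1 - p) := mul_nonneg hp0 (by linarith)
  -- If `p (1 - p) = 0` the quotient is `0` by convention, consistently, since positivity then
  -- forces the coherence to vanish.
  refine ⟨p, ⟨hp0, hp1⟩, ‖ρ 0 1‖ / √(p * (1 - p)), ⟨by positivity, ?_⟩, ρ 0 1, hρ, ?_⟩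
  · exact div_le_one_of_le₀ (Real.le_sqrt_of_sq_le hdet) (Real.sqrt_nonneg _)
  · rw [mul_assoc, div_pow, Real.sq_sqrt hpp]
    rcases hpp.eq_or_lt with h0 | h0
    · rw [← h0] at hdet ⊢
      simpa using le_antisymm hdet (by positivity)
    · rw [div_mul_cancel₀ _ h0.ne']

lemma entropy_qubit_eq (p : ℝ) (c : ℂ) :
    entropy (qubit p c) = detEntropy (p * (1 - p) - ‖c‖ ^ 2) / Real.log 2 := by
  apply entropy_qubit
  · ext i j
    fin_cases i <;> fin_cases j <;> simp [qubit]
  · simp [qubit, trace_fin_two]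
  · have h2 : c * star c = ((‖c‖ ^ 2 : ℝ) : ℂ) := by
      rw [← starRingEnd_apply, Complex.mul_conj, Complex.normSq_eq_norm_sq]
    simp only [qubit, det_fin_two_of, h2]
    push_cast; ring

lemma amplitudeDamping_qubit {η : ℝ} (h0 : 0 ≤ η) (h1 : η ≤ 1) (p : ℝ) (c : ℂ) :
    amplitudeDamping η (qubit p c) = qubit (η * p) (√η * c) := by
  have e0 : (√η : ℂ) * √η = η := by exact_mod_cast Real.mul_self_sqrt h0
  have e1 : (√(1 - η) : ℂ) * √(1 - η) = 1 - η := by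
    exact_mod_cast Real.mul_self_sqrt (sub_nonneg.2 h1)
  rw [amplitudeDamping, krausMap, LinearMap.coe_mk, AddHom.coe_mk, Fin.sum_univ_two]
  ext i j
  simp only [Matrix.add_apply, Matrix.mul_apply, Fin.sum_univ_two, conjTranspose_apply]
  fin_cases i <;> fin_cases j <;> simp [qubit]
  · linear_combination (p : ℂ) * e1
  · ring
  · linear_combination (p : ℂ) * e0

lemma norm_sqrt_mul_sq {z : ℝ} (h0 : 0 ≤ z) (c : ℂ) : ‖(√z : ℂ) * c‖ ^ 2 = z * ‖c‖ ^ 2 := by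
  rw [norm_mul, mul_pow, Complex.norm_real, Real.norm_eq_abs, sq_abs, Real.sq_sqrt h0]

lemma entropy_qubit_sqrt {z p ν : ℝ} {c : ℂ} (h0 : 0 ≤ z)
    (hc : ‖c‖ ^ 2 = ν ^ 2 * p * (1 - p)) : entropy (qubit (z * p) (√z * c)) = g p z ν := by
  rw [entropy_qubit_eq, norm_sqrt_mul_sq h0, hc, g_eq_detEntropy_div, outDet]
  ring_nf

/-! ### Entropies of the output ensemble -/

lemma traceLeft_applyRight {A A' B : Type*} [Fintype A]
    (𝒩 : Matrix A' A' ℂ →ₗ[ℂ] Matrix B B ℂ) (M : Matrix (A × A') (A × A') ℂ) :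
    traceLeft (applyRight 𝒩 M) = 𝒩 (traceLeft M) := by
  have : traceLeft M = ∑ a, Matrix.of fun s t => M (a, s) (a, t) := by
    ext i j; simp [traceLeft, Matrix.sum_apply]
  rw [this, map_sum]
  ext i j
  simp [traceLeft, applyRight, Matrix.sum_apply]

lemma trace_traceLeft {A B : Type*} [Fintype A] [Fintype B] (M : Matrix (A × B) (A × B) ℂ) :
    (traceLeft M).trace = M.trace := by
  simp only [traceLeft, Matrix.trace, diag_apply, of_apply, Fintype.sum_prod_type]
  exact Finset.sum_comm

/-- The isometric extension of a Kraus map applied to the vector `φ`: the columns are the vectors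
`(1 ⊗ Kⱼ) φ`. -/
def krausVector {J A A' B : Type*} [Fintype A'] (K : J → Matrix B A' ℂ) (φ : A × A' → ℂ) :
    Matrix (A × B) J ℂ :=
  Matrix.of fun i j => ∑ s, K j i.2 s * φ (i.1, s)

lemma applyRight_krausMap {J A A' B : Type*} [Fintype J] [Fintype A']
    (K : J → Matrix B A' ℂ) (φ : A × A' → ℂ) :
    applyRight (krausMap K) (ketBra φ) = krausVector K φ * (krausVector K φ)ᴴ := by
  ext ⟨a, b⟩ ⟨a', b'⟩
  simp only [applyRight, krausMap, krausVector, ketBra, LinearMap.coe_mk, AddHom.coe_mk, of_apply,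
    Matrix.sum_apply, Matrix.mul_apply, conjTranspose_apply, vecMulVec_apply, Pi.star_apply,
    star_sum, star_mul']
  refine Finset.sum_congr rfl fun j _ => ?_
  rw [Finset.mul_sum]
  refine Finset.sum_congr rfl fun t _ => ?_
  rw [Finset.sum_mul, Finset.sum_mul]
  exact Finset.sum_congr rfl fun s _ => by ring

/-- These are the entries of the environment state, up to a transpose that does not affect its
spectrum; they depend on `φ` only through the channel input. -/
lemma krausVector_conjTranspose_mul {J A A' B : Type*} [Fintype A] [Fintype A'] [Fintype B]
    (K : J → Matrix B A' ℂ) (φ : A × A' → ℂ) (j k : J) :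
    ((krausVector K φ)ᴴ * krausVector K φ) j k
      = (K k * traceLeft (ketBra φ) * (K j)ᴴ).trace := by
  simp only [krausVector, ketBra, traceLeft, Matrix.trace, diag_apply, of_apply, Matrix.mul_apply,
    conjTranspose_apply, vecMulVec_apply, Pi.star_apply, star_sum, star_mul',
    Fintype.sum_prod_type, Finset.sum_mul, Finset.mul_sum]
  rw [Finset.sum_comm]
  refine Finset.sum_congr rfl fun b _ => ?_
  rw [Finset.sum_comm]
  conv_rhs => rw [Finset.sum_comm]
  refine Finset.sum_congr rfl fun t _ => ?_
  rw [Finset.sum_comm]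
  refine Finset.sum_congr rfl fun s _ => Finset.sum_congr rfl fun a _ => ?_
  ring

lemma posSemidef_traceLeft_ketBra {A A' : Type*} [Fintype A] [Fintype A'] (φ : A × A' → ℂ) :
    (traceLeft (ketBra φ)).PosSemidef := by
  have : traceLeft (ketBra φ) = ∑ a, vecMulVec (fun s => φ (a, s)) (star fun s => φ (a, s)) := by
    ext i j; simp [traceLeft, ketBra, Matrix.sum_apply, vecMulVec_apply]
  rw [this]
  exact posSemidef_sum _ fun a _ => posSemidef_vecMulVec_self_star _

/-- The Kraus operators of the amplitude damping channel. -/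
def dampingKraus (η : ℝ) : Fin 2 → Matrix (Fin 2) (Fin 2) ℂ :=
  ![!![1, 0; 0, (√η : ℂ)], !![0, (√(1 - η) : ℂ); 0, 0]]

/-- The environment of the amplitude damping channel of transmissivity `η` receives the output of
the one of transmissivity `1 - η`. -/
lemma krausVector_dampingKraus {A : Type*} [Fintype A] {η : ℝ} (h0 : 0 ≤ η) (h1 : η ≤ 1)
    {φ : A × Fin 2 → ℂ} {p : ℝ} {c : ℂ} (h : traceLeft (ketBra φ) = qubit p c) :
    (krausVector (dampingKraus η) φ)ᴴ * krausVector (dampingKraus η) φ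
      = qubit ((1 - η) * p) (√(1 - η) * star c) := by
  have e0 : (√η : ℂ) * √η = η := by exact_mod_cast Real.mul_self_sqrt h0
  have e1 : (√(1 - η) : ℂ) * √(1 - η) = 1 - η := by
    exact_mod_cast Real.mul_self_sqrt (sub_nonneg.2 h1)
  ext j k
  rw [krausVector_conjTranspose_mul, h, trace_fin_two]
  simp only [Matrix.mul_apply, Fin.sum_univ_two, conjTranspose_apply]
  fin_cases j <;> fin_cases k <;> simp [qubit, dampingKraus]
  · linear_combination (p : ℂ) * e0
  · ring
  · linear_combination (p : ℂ) * e1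

lemma trace_qubit (p : ℝ) (c : ℂ) : (qubit p c).trace = 1 := by
  simp [qubit, trace_fin_two]

lemma isHermitian_qubit (p : ℝ) (c : ℂ) : (qubit p c).IsHermitian := by
  ext i j
  fin_cases i <;> fin_cases j <;> simp [qubit]

lemma sum_smul_qubit {X : Type*} [Fintype X] {q : X → ℝ} (hq : ∑ x, q x = 1) (p : X → ℝ) (c : X → ℂ) :
    ∑ x, (q x : ℂ) • qubit (p x) (c x) = qubit (∑ x, q x * p x) (∑ x, q x * c x) := by
  ext i j
  rw [Matrix.sum_apply]
  fin_cases i <;> fin_cases j <;> simp [qubit]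
  have : (∑ x, (q x : ℂ)) = 1 := by exact_mod_cast hq
  simp [mul_sub, this]

namespace Ensemble

variable {X A : Type*} [Fintype X] [Fintype A]

lemma trace_inputState {A' : Type*} [Fintype A'] (e : Ensemble X A A') (x : X) :
    (e.inputState x).trace = 1 := by
  rw [inputState, trace_traceLeft, Matrix.trace]
  have : ∀ i, (ketBra (e.φ x)).diag i = ((‖e.φ x i‖ ^ 2 : ℝ) : ℂ) := fun i => by
    rw [diag_apply, ketBra, vecMulVec_apply, Pi.star_apply, ← starRingEnd_apply, Complex.mul_conj,
      Complex.normSq_eq_norm_sq]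
  rw [Finset.sum_congr rfl fun i _ => this i, ← Complex.ofReal_sum, e.φ_unit x, Complex.ofReal_one]

lemma posSemidef_inputState {A' : Type*} [Fintype A'] (e : Ensemble X A A') (x : X) :
    (e.inputState x).PosSemidef :=
  posSemidef_traceLeft_ketBra _

variable {η : ℝ} (e : Ensemble X A (Fin 2)) {p ν : X → ℝ} {c : X → ℂ}

lemma trace_applyRight (h0 : 0 ≤ η) (h1 : η ≤ 1)
    (hρ : ∀ x, e.inputState x = qubit (p x) (c x)) (x : X) :
    (applyRight (amplitudeDamping η) (ketBra (e.φ x))).trace = 1 := by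
  have hx : traceLeft (ketBra (e.φ x)) = _ := hρ x
  rw [← trace_traceLeft, traceLeft_applyRight, hx, amplitudeDamping_qubit h0 h1, trace_qubit]

variable [DecidableEq X]

lemma cqState_eq_cqMatrix {A' B : Type*} [Fintype A'] [Fintype B] (e : Ensemble X A A')
    (𝒩 : Matrix A' A' ℂ →ₗ[ℂ] Matrix B B ℂ) :
    e.cqState 𝒩 = cqMatrix e.prob fun x => applyRight 𝒩 (ketBra (e.φ x)) := by
  ext ⟨x, i⟩ ⟨y, j⟩
  simp only [cqState, cqMatrix, Matrix.sum_apply, Matrix.smul_apply, kroneckerMap_apply, of_apply,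
    smul_eq_mul, single_apply]
  rw [Finset.sum_eq_single x]
  · simp
  · intro z _ hz
    simp [hz]
  · simp

lemma entropy_traceMiddle_cqState (h0 : 0 ≤ η) (h1 : η ≤ 1)
    (hρ : ∀ x, e.inputState x = qubit (p x) (c x))
    (hc : ∀ x, ‖c x‖ ^ 2 = ν x ^ 2 * p x * (1 - p x)) :
    entropy (traceMiddle (e.cqState (amplitudeDamping η)))
      = ∑ x, entropyTerm (e.prob x) + ∑ x, e.prob x * g (p x) η (ν x) := by
  have hm : traceMiddle (e.cqState (amplitudeDamping η))
      = cqMatrix e.prob fun x => qubit (η * p x) (√η * c x) := by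
    have : ∀ x, qubit (η * p x) (√η * c x)
        = traceLeft (applyRight (amplitudeDamping η) (ketBra (e.φ x))) := fun x => by
      have hx : traceLeft (ketBra (e.φ x)) = _ := hρ x
      rw [traceLeft_applyRight, hx, amplitudeDamping_qubit h0 h1]
    simp only [this, cqState_eq_cqMatrix]
    ext ⟨x, i⟩ ⟨y, j⟩
    rcases eq_or_ne x y with rfl | hxy
    · simp [traceMiddle, cqMatrix, traceLeft, Finset.mul_sum]
    · simp [traceMiddle, cqMatrix, hxy]
  rw [hm, entropy_cqMatrix _ (fun x => isHermitian_qubit _ _) (fun x => trace_qubit _ _)]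
  congr 1
  exact Finset.sum_congr rfl fun x _ => by rw [entropy_qubit_sqrt h0 (hc x)]

lemma entropy_traceRight_cqState (h0 : 0 ≤ η) (h1 : η ≤ 1)
    (hρ : ∀ x, e.inputState x = qubit (p x) (c x)) :
    entropy (traceRight (e.cqState (amplitudeDamping η))) = ∑ x, entropyTerm (e.prob x) := by
  rw [← entropy_diagonal]
  congr 1
  rw [cqState_eq_cqMatrix]
  ext x y
  rcases eq_or_ne x y with rfl | hxy
  · have := e.trace_applyRight h0 h1 hρ x
    rw [Matrix.trace] at this
    simp only [diag_apply] at this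
    simp [traceRight, cqMatrix, ← Finset.mul_sum, this]
  · simp [traceRight, cqMatrix, hxy]

lemma entropy_output_cqState (h0 : 0 ≤ η) (h1 : η ≤ 1)
    (hρ : ∀ x, e.inputState x = qubit (p x) (c x)) :
    entropy (traceLeft (traceLeft (e.cqState (amplitudeDamping η))))
      = entropy (qubit (η * ∑ x, e.prob x * p x) (√η * ∑ x, e.prob x * c x)) := by
  rw [← amplitudeDamping_qubit h0 h1, ← sum_smul_qubit e.prob_sum]
  congr 1
  have : traceLeft (e.cqState (amplitudeDamping η))
      = applyRight (amplitudeDamping η) (∑ x, (e.prob x : ℂ) • ketBra (e.φ x)) := by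
    rw [cqState_eq_cqMatrix]
    ext i j
    have hs : (Matrix.of fun s t => (∑ x, (e.prob x : ℂ) • ketBra (e.φ x)) (i.1, s) (j.1, t))
        = ∑ x, (e.prob x : ℂ) • Matrix.of fun s t => ketBra (e.φ x) (i.1, s) (j.1, t) := by
      ext s t; simp [Matrix.sum_apply]
    rw [applyRight, of_apply, hs, map_sum]
    simp only [map_smul]
    simp [traceLeft, cqMatrix, applyRight, Matrix.sum_apply]
  rw [this, traceLeft_applyRight]
  congr 1
  simp only [← hρ]
  ext s t
  simp only [inputState, traceLeft, Matrix.sum_apply, Matrix.smul_apply, of_apply, smul_eq_mul,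
    Finset.mul_sum]
  exact Finset.sum_comm

variable [DecidableEq A]

/-- For each `x` the state of `A`, `B` and the environment is pure, so the entropy of `AB` is that
of the environment, a qubit damped with transmissivity `1 - η`. -/
lemma entropy_cqState (h0 : 0 ≤ η) (h1 : η ≤ 1)
    (hρ : ∀ x, e.inputState x = qubit (p x) (c x))
    (hc : ∀ x, ‖c x‖ ^ 2 = ν x ^ 2 * p x * (1 - p x)) :
    entropy (e.cqState (amplitudeDamping η))
      = ∑ x, entropyTerm (e.prob x) + ∑ x, e.prob x * g (p x) (1 - η) (ν x) := by
  have hV : ∀ x, applyRight (amplitudeDamping η) (ketBra (e.φ x)) = _ :=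
    fun x => applyRight_krausMap (dampingKraus η) (e.φ x)
  rw [cqState_eq_cqMatrix, entropy_cqMatrix _ (fun x => ?_) (e.trace_applyRight h0 h1 hρ)]
  · congr 1
    refine Finset.sum_congr rfl fun x _ => ?_
    rw [hV, entropy_mul_conjTranspose, krausVector_dampingKraus h0 h1 (hρ x),
      entropy_qubit_sqrt (sub_nonneg.2 h1)]
    rw [norm_star, hc]
  · rw [hV]
    exact isHermitian_mul_conjTranspose_self _

lemma coherentInfo_eq (h0 : 0 ≤ η) (h1 : η ≤ 1)
    (hρ : ∀ x, e.inputState x = qubit (p x) (c x))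
    (hc : ∀ x, ‖c x‖ ^ 2 = ν x ^ 2 * p x * (1 - p x)) :
    e.coherentInfo (amplitudeDamping η)
      = ∑ x, e.prob x * g (p x) η (ν x) - ∑ x, e.prob x * g (p x) (1 - η) (ν x) := by
  rw [coherentInfo, e.entropy_cqState h0 h1 hρ hc, e.entropy_traceMiddle_cqState h0 h1 hρ hc]
  ring

lemma holevoInfo_add_coherentInfo_eq (h0 : 0 ≤ η) (h1 : η ≤ 1)
    (hρ : ∀ x, e.inputState x = qubit (p x) (c x))
    (hc : ∀ x, ‖c x‖ ^ 2 = ν x ^ 2 * p x * (1 - p x)) :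
    e.holevoInfo (amplitudeDamping η) + e.coherentInfo (amplitudeDamping η)
      = entropy (qubit (η * ∑ x, e.prob x * p x) (√η * ∑ x, e.prob x * c x))
        - ∑ x, e.prob x * g (p x) (1 - η) (ν x) := by
  rw [holevoInfo, coherentInfo, e.entropy_cqState h0 h1 hρ hc, e.entropy_traceRight_cqState h0 h1 hρ,
    e.entropy_output_cqState h0 h1 hρ]
  ring

/-- The rates of an ensemble are dominated by those of a single pair of parameters. -/
lemma exists_polyhedron (hη : 1 / 2 ≤ η) (h1 : η ≤ 1) :
    ∃ p ∈ Icc (0 : ℝ) 1, ∃ ν ∈ Icc (0 : ℝ) 1,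
      e.coherentInfo (amplitudeDamping η) ≤ g p η ν - g p (1 - η) ν ∧
      e.holevoInfo (amplitudeDamping η) + e.coherentInfo (amplitudeDamping η)
        ≤ h2 (η * p) - g p (1 - η) ν := by
  have h0 : 0 ≤ η := by linarith
  have hlog : 0 < Real.log 2 := Real.log_pos one_lt_two
  choose p hp ν hν c hρ hc using
    fun x => exists_eq_qubit (e.posSemidef_inputState x) (e.trace_inputState x)
  obtain ⟨ν', hν', hE, hB⟩ := exists_coherence_sum hη h1 e.prob_nonneg e.prob_sum hp hν
  have hE' : g (∑ x, e.prob x * p x) (1 - η) ν' = ∑ x, e.prob x * g (p x) (1 - η) (ν x) := by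
    simp only [g_eq_detEntropy_div, hE, Finset.sum_div, mul_div_assoc]
  have hB' : ∑ x, e.prob x * g (p x) η (ν x) ≤ g (∑ x, e.prob x * p x) η ν' := by
    simp only [g_eq_detEntropy_div, ← mul_div_assoc, ← Finset.sum_div]
    exact div_le_div_of_nonneg_right hB hlog.le
  have hav : (∑ x, (e.prob x : ℂ) • qubit (p x) (c x)).PosSemidef :=
    posSemidef_sum _ fun x _ => by
      rw [← hρ x]
      exact (e.posSemidef_inputState x).smul (by exact_mod_cast e.prob_nonneg x)
  rw [sum_smul_qubit e.prob_sum] at hav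
  -- The average input is itself a state, so its coherence has the form `μ √(r (1 - r))` in modulus.
  -- This `μ` serves only to bound `H(B)` and is unrelated to `ν'`.
  obtain ⟨r, hr, μ, hμ, d, hd, hdμ⟩ := exists_eq_qubit hav (trace_qubit _ _)
  have hr' : ∑ x, e.prob x * p x = r := by
    have := congrFun (congrFun hd 1) 1
    simp only [qubit, of_apply, cons_val', cons_val_one, cons_val_fin_one] at this
    exact_mod_cast this
  have hd' : ∑ x, (e.prob x : ℂ) * c x = d := by
    have := congrFun (congrFun hd 0) 1
    simpa [qubit] using this
  rw [hr'] at hE' hB'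
  refine ⟨r, hr, ν', hν', ?_, ?_⟩
  · rw [e.coherentInfo_eq h0 h1 hρ hc, hE']
    linarith
  · rw [e.holevoInfo_add_coherentInfo_eq h0 h1 hρ hc, hE', hr', hd', entropy_qubit_sqrt h0 hdμ,
      g_eq_detEntropy_div, h2_eq_binEntropy_div, ← detEntropy_mul_one_sub]
    -- Removing the coherence can only increase the determinant, hence the entropy, of the average
    -- output.
    have hm := outDet_mem ⟨h0, h1⟩ hr hμ
    have hle := outDet_le (ν := μ) h0 hr
    have := strictMonoOn_detEntropy.monotoneOn hm
      ⟨hm.1.trans hle, mul_one_sub_le_quarter _⟩ hle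
    have := div_le_div_of_nonneg_right this hlog.le
    linarith

end Ensemble

/-! ### The symmetric ensembles -/

lemma qubitState_eq_qubit (p ν : ℝ) :
    qubitState p ν = qubit p ((ν * √(p * (1 - p)) : ℝ) : ℂ) := by
  ext i j
  fin_cases i <;> fin_cases j <;> simp [qubitState, qubit]

lemma norm_coherence_sq {p : ℝ} (hp : p ∈ Icc (0 : ℝ) 1) (ν : ℝ) :
    ‖((ν * √(p * (1 - p)) : ℝ) : ℂ)‖ ^ 2 = ν ^ 2 * p * (1 - p) := by
  rw [Complex.norm_real, Real.norm_eq_abs, sq_abs, mul_pow,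
    Real.sq_sqrt (mul_nonneg hp.1 (by linarith [hp.2])), mul_assoc]

lemma IsSymmetricEnsemble.rates {A : Type*} [Fintype A] [DecidableEq A] {η p ν : ℝ}
    (h0 : 0 ≤ η) (h1 : η ≤ 1) (hp : p ∈ Icc (0 : ℝ) 1) {e : Ensemble (Fin 2) A (Fin 2)}
    (he : IsSymmetricEnsemble p ν e) :
    e.coherentInfo (amplitudeDamping η) = g p η ν - g p (1 - η) ν ∧
      e.holevoInfo (amplitudeDamping η) + e.coherentInfo (amplitudeDamping η)
        = h2 (η * p) - g p (1 - η) ν := by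
  obtain ⟨hq, hρ0, hρ1⟩ := he
  set c : Fin 2 → ℂ := ![((ν * √(p * (1 - p)) : ℝ) : ℂ), ((-ν * √(p * (1 - p)) : ℝ) : ℂ)] with hcdef
  have hρ : ∀ x, e.inputState x = qubit ((fun _ => p) x) (c x) := by
    intro x
    fin_cases x
    · simpa [hcdef, qubitState_eq_qubit] using hρ0
    · simpa [hcdef, qubitState_eq_qubit] using hρ1
  have hc : ∀ x, ‖c x‖ ^ 2
      = ((fun _ => ν) x) ^ 2 * ((fun _ => p) x) * (1 - ((fun _ => p) x)) := by
    intro x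
    fin_cases x
    · exact norm_coherence_sq hp ν
    · have := norm_coherence_sq hp (-ν)
      rw [neg_sq] at this
      exact this
  -- Opposite coherences with equal weights cancel, so the average output is diagonal and the bound
  -- on `H(B)` is attained.
  have hsum : ∑ x, (e.prob x : ℂ) * c x = 0 := by
    simp [Fin.sum_univ_two, hq, hcdef]
  have hav : ∀ y : ℝ, ∑ x, e.prob x * y = y := fun y => by
    rw [← Finset.sum_mul, e.prob_sum, one_mul]
  constructor
  · rw [e.coherentInfo_eq h0 h1 hρ hc, hav, hav]
  · rw [e.holevoInfo_add_coherentInfo_eq h0 h1 hρ hc, hav, hav, hsum, entropy_qubit_eq,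
      h2_eq_binEntropy_div, ← detEntropy_mul_one_sub]
    simp

/-- A purification of the qubit state with parameters `p` and `ν`. -/
def purification (p ν : ℝ) : Fin 2 × Fin 2 → ℂ := fun i =>
  ((!![ν * √(1 - p), √p; √(1 - ν ^ 2) * √(1 - p), 0] i.1 i.2 : ℝ) : ℂ)

lemma traceLeft_purification {p ν : ℝ} (hp : p ∈ Icc (0 : ℝ) 1) (hν : ν ^ 2 ≤ 1) :
    traceLeft (ketBra (purification p ν)) = qubitState p ν := by
  have e1 := Real.mul_self_sqrt (sub_nonneg.2 hp.2)
  have e2 := Real.mul_self_sqrt hp.1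
  have e3 := Real.mul_self_sqrt (sub_nonneg.2 hν)
  rw [qubitState, Real.sqrt_mul hp.1]
  ext i j
  fin_cases i <;> fin_cases j <;>
    simp [traceLeft, ketBra, purification, vecMulVec_apply] <;> norm_cast
  · linear_combination (ν ^ 2 + √(1 - ν ^ 2) * √(1 - ν ^ 2)) * e1 + (1 - p) * e3
  · ring
  · ring

lemma purification_unit {p ν : ℝ} (hp : p ∈ Icc (0 : ℝ) 1) (hν : ν ^ 2 ≤ 1) :
    ∑ i, ‖purification p ν i‖ ^ 2 = 1 := by
  have e1 := Real.mul_self_sqrt (sub_nonneg.2 hp.2)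
  have e2 := Real.mul_self_sqrt hp.1
  have e3 := Real.mul_self_sqrt (sub_nonneg.2 hν)
  simp only [purification, Complex.norm_real, Real.norm_eq_abs, sq_abs, Fintype.sum_prod_type,
    Fin.sum_univ_two]
  simp
  linear_combination (ν ^ 2 + √(1 - ν ^ 2) * √(1 - ν ^ 2)) * e1 + (1 - p) * e3 + e2

lemma exists_isSymmetricEnsemble {p ν : ℝ} (hp : p ∈ Icc (0 : ℝ) 1) (hν : ν ∈ Icc (0 : ℝ) 1) :
    ∃ e : Ensemble (Fin 2) (Fin 2) (Fin 2), IsSymmetricEnsemble p ν e := by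
  have hν1 : ν ^ 2 ≤ 1 := pow_le_one₀ hν.1 hν.2
  have hν2 : (-ν) ^ 2 ≤ 1 := by rwa [neg_sq]
  refine ⟨⟨fun _ => 1 / 2, fun _ => by norm_num, by norm_num [Fin.sum_univ_two],
    ![purification p ν, purification p (-ν)], fun x => ?_⟩, fun _ => rfl,
    traceLeft_purification hp hν1, traceLeft_purification hp hν2⟩
  fin_cases x
  · exact purification_unit hp hν1
  · exact purification_unit hp hν2

end CQTradeoff

end

theorem theorem2 (η : ℝ) (hη : 1 / 2 ≤ η) (hη1 : η ≤ 1) :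
    CQTradeoff.tradeoffRegion (CQTradeoff.amplitudeDamping η) =
        (⋃ p ∈ Set.Icc (0 : ℝ) 1, ⋃ ν ∈ Set.Icc (0 : ℝ) 1, CQTradeoff.polyhedron η p ν) ∧
      ∀ p ∈ Set.Icc (0 : ℝ) 1, ∀ ν ∈ Set.Icc (0 : ℝ) 1,
        (∃ e : CQTradeoff.Ensemble (Fin 2) (Fin 2) (Fin 2),
          CQTradeoff.IsSymmetricEnsemble p ν e) ∧
        ∀ (d : ℕ) (e : CQTradeoff.Ensemble (Fin 2) (Fin d) (Fin 2)),
          CQTradeoff.IsSymmetricEnsemble p ν e →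
            e.coherentInfo (CQTradeoff.amplitudeDamping η) =
                CQTradeoff.g p η ν - CQTradeoff.g p (1 - η) ν ∧
              e.holevoInfo (CQTradeoff.amplitudeDamping η) +
                  e.coherentInfo (CQTradeoff.amplitudeDamping η) =
                CQTradeoff.h2 (η * p) - CQTradeoff.g p (1 - η) ν := by
  have h0 : 0 ≤ η := by linarith
  refine ⟨?_, fun p hp ν hν => ⟨CQTradeoff.exists_isSymmetricEnsemble hp hν, fun d e he =>
    he.rates h0 hη1 hp⟩⟩
  ext ⟨C, Q⟩
  simp only [Set.mem_iUnion, exists_prop]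
  constructor
  · rintro ⟨k, d, e, hQ, hCQ⟩
    obtain ⟨p, hp, ν, hν, h1, h2⟩ := e.exists_polyhedron hη hη1
    exact ⟨p, hp, ν, hν, hQ.trans h1, hCQ.trans h2⟩
  · rintro ⟨p, hp, ν, hν, hQ, hCQ⟩
    obtain ⟨e, he⟩ := CQTradeoff.exists_isSymmetricEnsemble hp hν
    obtain ⟨h1, h2⟩ := he.rates h0 hη1 hp
    exact ⟨2, 2, e, hQ.trans_eq h1.symm, hCQ.trans_eq h2.symm⟩
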